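/- Let $(\xi_j,A_j,B_j,\eta_j)$, $j=1,2$, be two 4-tuples, where $\xi_j,\eta_j$ are nonzero nonnegative real vectors of size $m_j$ and $A_j,B_j$ are nonnegative real $m_j\times m_j$ matrices such that $M_j=A_j+B_j$ is primitive. Let $\lambda_j$ be the Perron–Frobenius eigenvalue of $M_j$ and assume $\lambda_1=\lambda_2$. Let $u_j(z)$ be the function, analytic near $z=0$, defined by $\mathrm{Det}(u_j(z) I-A_je^z-B_j)=0$ and $u_j(0)=\lambda_j$, and put $$\beta_j=\frac{u_j'(0)}{\lambda_j},\qquad \gamma_j=\frac{u_j''(0)}{\lambda_j}-\Big(\frac{u_j'(0)}{\lambda_j}\Big)^2 .$$ Assume that each pair $(A_j,B_j)$ is aperiodic in the following sense: in the directed graph on $\{1,\dots,m_j\}$ having an edge from $p$ to $q$ labelled $a$ whenever $(A_j)_{pq}>0$, and one labelled $b$ whenever $(B_j)_{pq}>0$, the greatest common divisor of all differences $|\ell(\mathcal C_1)|_a-|\ell(\mathcal C_2)|_a$, over cycles (closed walks) $\mathcal C_1,\mathcal C_2$ of equal length, is $1$; here $\ell(\mathcal C)$ is the word labelling $\mathcal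 C$ and $|w|_a$ is the number of occurrences of $a$ in the word $w$. Let $\xi'=(\xi_1',\xi_2')$, $A=\mathrm{diag}(A_1,A_2)$, $B=\mathrm{diag}(B_1,B_2)$ (block diagonal), $\eta=(\eta_1;\eta_2)$, let $\mu$ be the monoid morphism on $\{a,b\}^*$ with $\mu(a)=A$, $\mu(b)=B$, and assume that $A\ne 0\ne B$ and that for every $n\ge1$ some word $w$ of length $n$ has $\xi'\mu(w)\eta>0$. Let $Y_n=|w|_a$, where $w\in\{a,b\}^n$ is drawn with probability $\xi'\mu(w)\eta\,/\,\xi'(A+B)^n\eta$. If $\beta_1=\beta_2=\beta$ and $\gamma_1=\gamma_2=\gamma$, then $\gamma>0$ and, as $n\to+\infty$, $$\left|\sqrt n\,\Pr(Y_n=k)-\frac{e^{-\frac{(k-\beta n)^2}{2\gamma n}}}{\sqrt{2\pi\gamma}}\right|=O\left(n^{-1/2}\right)$$ uniformly for $k\in\{0,1,\dots,n\}$. -/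

import Mathlib

open Filter Topology
open scoped Matrix

/-- A linear representation `(ξ, A, B, η)` with nonnegative real entries, over the alphabet
`{a, b}`, with states indexed by the finite type `ι`. Throughout, the two letters are encoded by
`Bool`: the letter `a` is `true` and the letter `b` is `false`. -/
structure LinRep (ι : Type*) where
  ξ : ι → ℝ
  A : Matrix ι ι ℝ
  B : Matrix ι ι ℝ
  η : ι → ℝ
  ξ_nonneg : ∀ i, 0 ≤ ξ i
  A_nonneg : ∀ i j, 0 ≤ A i j
  B_nonneg : ∀ i j, 0 ≤ B i j
  η_nonneg : ∀ i, 0 ≤ η i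

namespace LinRep

section General

variable {ι : Type*} (R : LinRep ι)

/-- The matrix of a letter: `μ(a) = A`, `μ(b) = B`. -/
def letterMatrix (x : Bool) : Matrix ι ι ℝ := if x then R.A else R.B

/-- The total transition matrix `M = A + B`. -/
def M : Matrix ι ι ℝ := R.A + R.B

/-- Labels of walks in the transition graph: `R.IsWalk i w j` says that the graph with an edge
`i → j` labelled `a` whenever `A i j > 0`, and one labelled `b` whenever `B i j > 0`, has a walk
from `i` to `j` whose labels spell `w`. -/
inductive IsWalk : ι → List Bool → ι → Prop
  | nil (i : ι) : IsWalk i [] i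
  | cons {i j k : ι} {x : Bool} {w : List Bool} (hx : 0 < R.letterMatrix x i j)
      (hw : IsWalk j w k) : IsWalk i (x :: w) k

/-- `w` is the label of a cycle (closed walk of positive length) of the transition graph. -/
def IsCycleLabel (w : List Bool) : Prop := w ≠ [] ∧ ∃ i, R.IsWalk i w i

/-- The set of the differences `|ℓ(C₁)|_a - |ℓ(C₂)|_a` over the pairs of cycles `C₁`, `C₂` of
equal length. -/
def cycleDifferences : Set ℤ :=
  {x | ∃ w₁ w₂ : List Bool, R.IsCycleLabel w₁ ∧ R.IsCycleLabel w₂ ∧ w₁.length = w₂.length ∧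
    x = (w₁.count true : ℤ) - (w₂.count true : ℤ)}

/-- The pair `(A, B)` is aperiodic: the greatest common divisor of `cycleDifferences` is `1`,
i.e. `1` is the only natural number that divides all of them. -/
def AperiodicPair : Prop :=
  ∀ d : ℕ, (∀ x ∈ R.cycleDifferences, (d : ℤ) ∣ x) → d = 1

variable [Fintype ι] [DecidableEq ι]

/-- The monoid morphism `μ : {a,b}* → ℝ^{ι × ι}` generated by `A` and `B`. -/
def mu (w : List Bool) : Matrix ι ι ℝ := (w.map R.letterMatrix).prod

/-- The rational series `(r, w) = ξ' μ(w) η`. -/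
def series (w : List Bool) : ℝ := R.ξ ⬝ᵥ (R.mu w *ᵥ R.η)

/-- The standing assumptions on a stochastic model: for every `n ≥ 1` some word of length `n` has
positive weight, and `A ≠ 0 ≠ B`. -/
structure Admissible : Prop where
  exists_pos : ∀ n : ℕ, 1 ≤ n → ∃ w : Fin n → Bool, 0 < R.series (List.ofFn w)
  A_ne_zero : R.A ≠ 0
  B_ne_zero : R.B ≠ 0

/-- The probability `Pr(w) = (r, w) / ∑_{|x| = n} (r, x)` of a word `w` of length `n`. -/
noncomputable def wordProb {n : ℕ} (w : Fin n → Bool) : ℝ :=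
  R.series (List.ofFn w) / ∑ x : Fin n → Bool, R.series (List.ofFn x)

/-- `Pr(Y_n = k)`, where `Y_n = |w|_a` for a random word `w` of length `n`. -/
noncomputable def probY (n k : ℕ) : ℝ :=
  ∑ w : Fin n → Bool with (List.ofFn w).count true = k, R.wordProb w

/-- The Perron-Frobenius eigenvalue `λ` of `M = A + B`, i.e. the largest modulus of its complex
eigenvalues. -/
noncomputable def perronEigenvalue : ℝ :=
  (spectralRadius ℂ (R.M.map ((↑) : ℝ → ℂ))).toReal

/-- `u` is an analytic solution near `0` of `Det(u(z) I - A e^z - B) = 0`, `u(0) = λ`. -/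
structure IsPerronBranch (u : ℂ → ℂ) : Prop where
  analyticAt : AnalyticAt ℂ u 0
  map_zero : u 0 = (R.perronEigenvalue : ℂ)
  det_eq_zero : ∀ᶠ z in 𝓝 (0 : ℂ),
    (u z • (1 : Matrix ι ι ℂ) - Complex.exp z • R.A.map ((↑) : ℝ → ℂ)
      - R.B.map ((↑) : ℝ → ℂ)).det = 0

/-- The function `u = u(z)` implicitly defined by `Det(u I - A e^z - B) = 0` and `u(0) = λ`.
When `M` is primitive, `λ` is a simple eigenvalue, so `u` exists and is unique near `0`. -/
noncomputable def u : ℂ → ℂ := Classical.epsilon R.IsPerronBranch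

/-- `β = u'(0) / λ` (a real number, since `u` is real on the real axis near `0`). -/
noncomputable def beta : ℝ := (deriv R.u 0 / (R.perronEigenvalue : ℂ)).re

/-- `γ = u''(0) / λ - (u'(0) / λ)²` (again a real number). -/
noncomputable def gamma : ℝ :=
  (iteratedDeriv 2 R.u 0 / (R.perronEigenvalue : ℂ)
    - (deriv R.u 0 / (R.perronEigenvalue : ℂ)) ^ 2).re

end General

section Sum

variable {ι₁ ι₂ : Type*}

/-- The bicomponent linear representation without communication, with
`ξ' = (ξ₁', ξ₂')`, `A = diag(A₁, A₂)`, `B = diag(B₁, B₂)` and `η = (η₁, η₂)`. -/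
def directSum (R₁ : LinRep ι₁) (R₂ : LinRep ι₂) : LinRep (ι₁ ⊕ ι₂) where
  ξ := Sum.elim R₁.ξ R₂.ξ
  A := Matrix.fromBlocks R₁.A 0 0 R₂.A
  B := Matrix.fromBlocks R₁.B 0 0 R₂.B
  η := Sum.elim R₁.η R₂.η
  ξ_nonneg := by rintro (i | i) <;> simp [R₁.ξ_nonneg, R₂.ξ_nonneg]
  A_nonneg := by rintro (i | i) (j | j) <;> simp [R₁.A_nonneg, R₂.A_nonneg]
  B_nonneg := by rintro (i | i) (j | j) <;> simp [R₁.B_nonneg, R₂.B_nonneg]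
  η_nonneg := by rintro (i | i) <;> simp [R₁.η_nonneg, R₂.η_nonneg]

variable [Fintype ι₁] [DecidableEq ι₁] [Fintype ι₂] [DecidableEq ι₂]

/-- A sum model with components `R₁`, `R₂`. -/
structure IsSumModel (R₁ : LinRep ι₁) (R₂ : LinRep ι₂) : Prop where
  admissible : (R₁.directSum R₂).Admissible
  irreducible₁ : R₁.M.IsIrreducible
  irreducible₂ : R₂.M.IsIrreducible
  ξ₁_ne_zero : R₁.ξ ≠ 0
  η₁_ne_zero : R₁.η ≠ 0
  ξ₂_ne_zero : R₂.ξ ≠ 0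
  η₂_ne_zero : R₂.η ≠ 0

/-- An equipotent sum model: `M₁` and `M₂` are primitive and `λ₁ = λ₂`. -/
structure IsEquipotentSumModel (R₁ : LinRep ι₁) (R₂ : LinRep ι₂) : Prop
    extends IsSumModel R₁ R₂ where
  primitive₁ : R₁.M.IsPrimitive
  primitive₂ : R₂.M.IsPrimitive
  perron_eq : R₁.perronEigenvalue = R₂.perronEigenvalue

end Sum

end LinRep

-- The function ξ'(A e^z + B)^n η at z = iθ is the unnormalised characteristic function of Y_n, and
-- Fourier inversion on [-π, π] recovers the probabilities. In a block-diagonal model it is the sum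
-- of the functions of the two components. For each component, after division by λ^n, it equals
-- c·exp(n(iβθ - γθ²/2)) up to O(|θ| e^{-anθ²} + ρ^n), with c > 0 and ρ < 1. As λ, β and γ agree,
-- the two approximations add up to a single Gaussian with factor c₁ + c₂. The error integrates to
-- O(1/n), and multiplication by √n leaves O(n^{-1/2}): this is `local_limit_of_norm_genFun_sub_le`.
--
-- For one component (`component_estimate`), conjugation by the Perron eigenvector and division by λ
-- make A + B row-stochastic. Near θ = 0 the eigenvalue branch u splits off from a remainder with
-- geometrically decaying powers (`exists_quasi_power`), and u^n is compared with the n-th power of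
-- the exponential having the same second-order expansion (`eventually_norm_pow_sub_exp_pow_le`).
-- Away from 0, an eigenvalue of modulus at least one would force equality in the triangle
-- inequality; the phases of the eigenvector are then transported along the edges, and aperiodicity
-- gives e^{iθ} = 1 (`norm_lt_one_of_mem_spectrum_tilt`).
--
-- Aperiodicity also yields γ > 0: `exists_moments` writes γ as a weighted sum of squares, which can
-- vanish only if the number of letters a in a cycle is proportional to its length.

attribute [local instance] Matrix.linftyOpNormedRing Matrix.linftyOpNormedAlgebra

/-! ### Uniform geometric decay of powers -/

section PowerBounds

variable {𝔸 : Type*} [NormedRing 𝔸] [NormedAlgebra ℂ 𝔸] [CompleteSpace 𝔸]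

theorem exists_norm_pow_lt_one [Nontrivial 𝔸] {a : 𝔸} (h : ∀ μ ∈ spectrum ℂ a, ‖μ‖ < 1) :
    ∃ m : ℕ, 0 < m ∧ ‖a ^ m‖ < 1 := by
  have h1 : spectralRadius ℂ a < (1 : NNReal) :=
    spectrum.spectralRadius_lt_of_forall_lt a fun z hz => by
      have := h z hz
      exact_mod_cast this
  have h2 := (spectrum.pow_norm_pow_one_div_tendsto_nhds_spectralRadius a).eventually_lt_const h1
  obtain ⟨m, hm, hm0⟩ := (h2.and (eventually_gt_atTop 0)).exists
  refine ⟨m, hm0, ?_⟩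
  by_contra! hc
  have : (1 : ℝ) ≤ ‖a ^ m‖ ^ (1 / m : ℝ) := Real.one_le_rpow hc (by positivity)
  have h3 : ENNReal.ofReal 1 ≤ ENNReal.ofReal (‖a ^ m‖ ^ (1 / m : ℝ)) :=
    ENNReal.ofReal_le_ofReal this
  simp at h3
  exact absurd hm (by simpa using h3)

/-- Controlling one power suffices: `‖S x ^ m‖ < q < 1` is an open condition in `x`, and division of
`n` by `m` leaves finitely many remainders, bounded together by `L`. -/
theorem eventually_forall_norm_pow_le {X : Type*} [TopologicalSpace X] [Nontrivial 𝔸] {S : X → 𝔸} {x₀ : X}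
    (hS : ContinuousAt S x₀) (h : ∀ μ ∈ spectrum ℂ (S x₀), ‖μ‖ < 1) :
    ∃ C ρ : ℝ, 0 ≤ C ∧ 0 ≤ ρ ∧ ρ < 1 ∧ ∀ᶠ x in 𝓝 x₀, ∀ n : ℕ, ‖S x ^ n‖ ≤ C * ρ ^ n := by
  obtain ⟨m, hm, hlt⟩ := exists_norm_pow_lt_one h
  obtain ⟨q, hq1, hq2⟩ := exists_between hlt
  have hq0 : 0 < q := (norm_nonneg _).trans_lt hq1
  set ρ : ℝ := q ^ (1 / m : ℝ) with hρ
  have hρ0 : 0 < ρ := Real.rpow_pos_of_pos hq0 _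
  have hρm : ρ ^ m = q := by
    rw [hρ, one_div, Real.rpow_inv_natCast_pow hq0.le hm.ne']
  have hρ1 : ρ < 1 := Real.rpow_lt_one hq0.le hq2 (by positivity)
  set L : ℝ := ∑ i ∈ Finset.range m, ‖S x₀ ^ i‖ + 1 with hL
  have hL0 : 0 ≤ L := by positivity
  have e1 : ∀ᶠ x in 𝓝 x₀, ‖S x ^ m‖ < q :=
    (hS.pow m).norm.eventually_lt_const hq1
  have e2 : ∀ᶠ x in 𝓝 x₀, ∑ i ∈ Finset.range m, ‖S x ^ i‖ < L := by
    have : ContinuousAt (fun x => ∑ i ∈ Finset.range m, ‖S x ^ i‖) x₀ :=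
      tendsto_finsetSum _ fun i _ => (hS.pow i).norm
    exact this.eventually_lt_const (by simp [hL])
  refine ⟨L / q, ρ, by positivity, hρ0.le, hρ1, ?_⟩
  filter_upwards [e1, e2] with x h1 h2 n
  have hmod : n % m < m := Nat.mod_lt _ hm
  have hr : ‖S x ^ (n % m)‖ ≤ L :=
    (Finset.single_le_sum (f := fun i => ‖S x ^ i‖) (fun i _ => norm_nonneg _)
      (Finset.mem_range.2 hmod)).trans h2.le
  have hpow : ‖S x ^ n‖ ≤ L * q ^ (n / m) := by
    rcases Nat.eq_zero_or_pos (n / m) with h0 | h0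
    · have : n % m = n := by
        have := Nat.div_add_mod n m
        rw [h0] at this; simpa using this
      rw [h0]; rw [this] at hr; simpa using hr
    · calc ‖S x ^ n‖ = ‖S x ^ (n % m) * (S x ^ m) ^ (n / m)‖ := by
            rw [← pow_mul, ← pow_add, Nat.mod_add_div]
        _ ≤ ‖S x ^ (n % m)‖ * ‖(S x ^ m) ^ (n / m)‖ := norm_mul_le _ _
        _ ≤ L * q ^ (n / m) := by
            gcongr
            exact (norm_pow_le' _ h0).trans (by gcongr)
  refine hpow.trans ?_
  -- The factor `1 / q` in the constant pays for rounding `n / m` down.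
  have : q * q ^ (n / m) ≤ ρ ^ n := by
    rw [← pow_succ', ← hρm, ← pow_mul]
    apply pow_le_pow_of_le_one hρ0.le hρ1.le
    have := Nat.lt_mul_div_succ n hm
    exact this.le
  calc L * q ^ (n / m) = L / q * (q * q ^ (n / m)) := by field_simp
    _ ≤ L / q * ρ ^ n := by gcongr

theorem IsCompact.exists_norm_pow_le {X : Type*} [TopologicalSpace X] [Nontrivial 𝔸] {S : X → 𝔸}
    {K : Set X} (hK : IsCompact K) (hS : Continuous S)
    (h : ∀ x ∈ K, ∀ μ ∈ spectrum ℂ (S x), ‖μ‖ < 1) :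
    ∃ C ρ : ℝ, 0 ≤ C ∧ 0 ≤ ρ ∧ ρ < 1 ∧ ∀ x ∈ K, ∀ n : ℕ, ‖S x ^ n‖ ≤ C * ρ ^ n := by
  refine hK.induction_on (p := fun K => ∃ C ρ : ℝ, 0 ≤ C ∧ 0 ≤ ρ ∧ ρ < 1 ∧ ∀ x ∈ K, ∀ n : ℕ,
    ‖S x ^ n‖ ≤ C * ρ ^ n) ⟨0, 0, le_rfl, le_rfl, one_pos, by simp⟩ ?_ ?_ ?_
  · rintro s t hst ⟨C, ρ, h0, h1, h2, h3⟩
    exact ⟨C, ρ, h0, h1, h2, fun x hx => h3 x (hst hx)⟩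
  · rintro s t ⟨C, ρ, h0, h1, h2, h3⟩ ⟨C', ρ', h0', h1', h2', h3'⟩
    refine ⟨max C C', max ρ ρ', le_max_of_le_left h0, le_max_of_le_left h1, max_lt h2 h2', ?_⟩
    rintro x (hx | hx) n
    · refine (h3 x hx n).trans ?_
      gcongr <;> simp
    · refine (h3' x hx n).trans ?_
      gcongr <;> simp
  · intro x hx
    obtain ⟨C, ρ, h0, h1, h2, h3⟩ := eventually_forall_norm_pow_le hS.continuousAt (h x hx)
    exact ⟨_, mem_nhdsWithin_of_mem_nhds h3, C, ρ, h0, h1, h2, fun y hy => hy⟩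

end PowerBounds

/-! ### Peripheral eigenvectors of stochastic pairs -/

theorem Matrix.exists_mulVec_eq_smul_of_mem_spectrum {ι : Type*} [Fintype ι] [DecidableEq ι]
    {S : Matrix ι ι ℂ} {μ : ℂ} (h : μ ∈ spectrum ℂ S) : ∃ x : ι → ℂ, x ≠ 0 ∧ S *ᵥ x = μ • x := by
  rw [spectrum.mem_iff, Matrix.isUnit_iff_isUnit_det, isUnit_iff_ne_zero, not_not,
    ← Matrix.exists_mulVec_eq_zero_iff] at h
  obtain ⟨x, hx, he⟩ := h
  refine ⟨x, hx, ?_⟩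
  rw [Matrix.sub_mulVec, sub_eq_zero, Matrix.algebraMap_eq_diagonal] at he
  rw [← he]
  ext i
  simp [Matrix.mulVec_diagonal]

/-- A convex combination of points of the unit disc lies on the circle only if the points of
positive weight coincide; multiplying by the conjugate of `d` reduces this to real parts being at
most 1. -/
theorem eq_of_sum_eq_of_norm_le_one {κ : Type*} {s : Finset κ} {p : κ → ℝ} {c : κ → ℂ} {d : ℂ}
    (hp : ∀ k ∈ s, 0 ≤ p k) (hsum : ∑ k ∈ s, p k = 1) (hc : ∀ k ∈ s, ‖c k‖ ≤ 1) (hd : ‖d‖ = 1)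
    (h : ∑ k ∈ s, (p k : ℂ) * c k = d) : ∀ k ∈ s, 0 < p k → c k = d := by
  have hdd : d * (starRingEnd ℂ) d = 1 := by
    rw [Complex.mul_conj, Complex.normSq_eq_norm_sq, hd]; simp
  have hre : ∀ k ∈ s, (c k * (starRingEnd ℂ) d).re ≤ 1 := fun k hk =>
    (Complex.re_le_norm _).trans (by simpa [hd] using hc k hk)
  have hz : ∑ k ∈ s, p k * (1 - (c k * (starRingEnd ℂ) d).re) = 0 := by
    have : ∑ k ∈ s, p k * (c k * (starRingEnd ℂ) d).re = 1 := by
      have := congrArg Complex.re (congrArg (· * (starRingEnd ℂ) d) h)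
      simp only [hdd, Finset.sum_mul, mul_assoc, Complex.re_sum, Complex.one_re,
        Complex.re_ofReal_mul] at this
      exact this
    simp only [mul_sub, mul_one, Finset.sum_sub_distrib, this, hsum, sub_self]
  intro k hk hpk
  have h0 := (Finset.sum_eq_zero_iff_of_nonneg fun k hk =>
    mul_nonneg (hp k hk) (sub_nonneg.2 (hre k hk))).1 hz k hk
  have h1 : (c k * (starRingEnd ℂ) d).re = 1 := by
    rcases mul_eq_zero.1 h0 with h | h <;> linarith
  have h2 : c k * (starRingEnd ℂ) d = 1 := by
    have hn : ‖c k * (starRingEnd ℂ) d‖ ≤ 1 := by simpa [hd] using hc k hk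
    apply Complex.ext h1
    have := Complex.sq_norm (c k * (starRingEnd ℂ) d)
    rw [Complex.normSq_apply, h1] at this
    have h3 : (c k * (starRingEnd ℂ) d).im * (c k * (starRingEnd ℂ) d).im ≤ 0 := by
      nlinarith [norm_nonneg (c k * (starRingEnd ℂ) d)]
    simpa using le_antisymm h3 (mul_self_nonneg _)
  calc c k = c k * (d * (starRingEnd ℂ) d) := by rw [hdd, mul_one]
    _ = (c k * (starRingEnd ℂ) d) * d := by ring
    _ = d := by rw [h2, one_mul]

/-- The matrix `A e^z + B`. -/
noncomputable def tilt {ι : Type*} (A B : Matrix ι ι ℝ) (z : ℂ) : Matrix ι ι ℂ :=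
  Complex.exp z • A.map ((↑) : ℝ → ℂ) + B.map ((↑) : ℝ → ℂ)

/-- A pair of nonnegative matrices whose sum is row-stochastic and primitive. -/
structure IsStochasticPair {ι : Type*} [Fintype ι] [DecidableEq ι] (A B : Matrix ι ι ℝ) :
    Prop where
  A_nonneg : ∀ i j, 0 ≤ A i j
  B_nonneg : ∀ i j, 0 ≤ B i j
  sum_row : ∀ i, ∑ j, (A + B) i j = 1
  primitive : (A + B).IsPrimitive

theorem tilt_apply {ι : Type*} (A B : Matrix ι ι ℝ) (z : ℂ) (i j : ι) :
    tilt A B z i j = Complex.exp z * A i j + B i j := by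
  simp [tilt]

theorem tilt_zero {ι : Type*} (A B : Matrix ι ι ℝ) :
    tilt A B 0 = (A + B).map ((↑) : ℝ → ℂ) := by
  ext i j; simp [tilt]

namespace IsStochasticPair

variable {ι : Type*} [Fintype ι] [DecidableEq ι] {A B : Matrix ι ι ℝ}

theorem add_nonneg' (h : IsStochasticPair A B) (i j : ι) : 0 ≤ (A + B) i j :=
  add_nonneg (h.A_nonneg i j) (h.B_nonneg i j)

section
variable (h : IsStochasticPair A B)
include h

theorem mulVec_one : (A + B) *ᵥ 1 = 1 := by
  ext i; simpa [Matrix.mulVec, dotProduct] using h.sum_row i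

theorem pow_mulVec_one (n : ℕ) : (A + B) ^ n *ᵥ 1 = 1 := by
  induction n with
  | zero => simp
  | succ n ih => rw [pow_succ, ← Matrix.mulVec_mulVec, h.mulVec_one, ih]

theorem pow_nonneg' (n : ℕ) (i j : ι) : 0 ≤ ((A + B) ^ n) i j :=
  Matrix.pow_apply_nonneg h.add_nonneg' n i j

/-- Maximum principle: iterating up to a power with positive entries, the maximal value is at most
an average of all values with positive weights, so all are maximal. -/
theorem eq_of_le_mulVec {y : ι → ℝ} (hy : ∀ i, y i ≤ ((A + B) *ᵥ y) i) (i j : ι) : y i = y j := by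
  obtain ⟨k, -, hk⟩ := h.primitive.exists_pos_pow
  have hmono : ∀ n, ∀ i, y i ≤ ((A + B) ^ n *ᵥ y) i := by
    intro n
    induction n with
    | zero => simp
    | succ n ih =>
      intro i
      refine (ih i).trans ?_
      rw [pow_succ, ← Matrix.mulVec_mulVec]
      exact Finset.sum_le_sum fun j _ => mul_le_mul_of_nonneg_left (hy j) (h.pow_nonneg' n i j)
  have : Nonempty ι := ⟨i⟩
  obtain ⟨m, -, hm⟩ := Finset.exists_max_image Finset.univ y Finset.univ_nonempty
  have key : ∀ j, y j = y m := by
    have h1 : ∑ j, ((A + B) ^ k) m j * (y m - y j) ≤ 0 := by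
      have h2 := congrFun (h.pow_mulVec_one k) m
      have h3 := hmono k m
      simp only [Matrix.mulVec, dotProduct, Pi.one_apply, mul_one] at h2 h3
      simp only [mul_sub, Finset.sum_sub_distrib, ← Finset.sum_mul, h2]
      linarith
    have h4 : ∀ j ∈ Finset.univ, 0 ≤ ((A + B) ^ k) m j * (y m - y j) := fun j _ =>
      mul_nonneg (hk m j).le (sub_nonneg.2 (hm j (Finset.mem_univ j)))
    have h5 := (Finset.sum_eq_zero_iff_of_nonneg h4).1 (le_antisymm h1 (Finset.sum_nonneg h4))
    intro j
    rcases mul_eq_zero.1 (h5 j (Finset.mem_univ j)) with h6 | h6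
    · exact absurd h6 (hk m j).ne'
    · linarith
  rw [key i, key j]

/-- The moduli `‖x i‖` are subharmonic, hence constant. Row `i` of the eigenvalue equation then
shows `μ * x i` as a convex combination of numbers of that same modulus, so every term of positive
weight equals it. -/
theorem phase_of_eigenvector {θ : ℝ} {μ : ℂ} {x : ι → ℂ} (hx : x ≠ 0) (hμ : 1 ≤ ‖μ‖)
    (he : tilt A B (θ * Complex.I) *ᵥ x = μ • x) :
    (∃ r : ℝ, 0 < r ∧ ∀ i, ‖x i‖ = r) ∧ ‖μ‖ = 1 ∧
    (∀ i j, 0 < A i j → Complex.exp (θ * Complex.I) * x j = μ * x i) ∧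
    (∀ i j, 0 < B i j → x j = μ * x i) := by
  have hexp : ‖Complex.exp (θ * Complex.I)‖ = 1 := Complex.norm_exp_ofReal_mul_I θ
  have hsum : ∀ i, ∑ j, (Complex.exp (θ * Complex.I) * A i j + B i j) * x j = μ * x i := by
    intro i
    have := congrFun he i
    simpa [Matrix.mulVec, dotProduct, tilt_apply] using this
  have hle : ∀ i, ‖μ‖ * ‖x i‖ ≤ ((A + B) *ᵥ fun j => ‖x j‖) i := by
    intro i
    rw [← norm_mul, ← hsum i]
    refine (norm_sum_le _ _).trans (Finset.sum_le_sum fun j _ => ?_)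
    rw [norm_mul]
    gcongr
    refine (norm_add_le _ _).trans ?_
    simp [hexp, abs_of_nonneg (h.A_nonneg i j), abs_of_nonneg (h.B_nonneg i j)]
  have hconst := h.eq_of_le_mulVec (y := fun j => ‖x j‖) fun i =>
    le_trans (by nlinarith [norm_nonneg (x i)]) (hle i)
  obtain ⟨i₀, hi₀⟩ : ∃ i, x i ≠ 0 := by
    by_contra! hc; exact hx (funext hc)
  set r := ‖x i₀‖ with hr
  have hr0 : 0 < r := norm_pos_iff.2 hi₀
  have hxr : ∀ i, ‖x i‖ = r := fun i => hconst i i₀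
  have hμ1 : ‖μ‖ = 1 := by
    refine le_antisymm ?_ hμ
    have h1 := hle i₀
    have h2 := h.sum_row i₀
    simp only [Matrix.mulVec, dotProduct, hxr, ← Finset.sum_mul, h2, one_mul] at h1
    exact le_of_mul_le_mul_right (by linarith) hr0
  refine ⟨⟨r, hr0, hxr⟩, hμ1, ?_⟩
  have key : ∀ i, ∀ k ∈ (Finset.univ : Finset (ι ⊕ ι)),
      0 < Sum.elim (fun j => A i j) (fun j => B i j) k →
      Sum.elim (fun j => Complex.exp (θ * Complex.I) * x j / r) (fun j => x j / r) k
        = μ * x i / r := by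
    intro i
    apply eq_of_sum_eq_of_norm_le_one
    · rintro (j | j) -
      · exact h.A_nonneg i j
      · exact h.B_nonneg i j
    · simp only [Fintype.sum_sum_type, Sum.elim_inl, Sum.elim_inr]
      rw [← Finset.sum_add_distrib]
      exact h.sum_row i
    · rintro (j | j) -
      · simp [hexp, hxr, abs_of_pos hr0, hr0.ne']
      · simp [hxr, abs_of_pos hr0, hr0.ne']
    · simp [hμ1, hxr, abs_of_pos hr0, hr0.ne']
    · simp only [Fintype.sum_sum_type, Sum.elim_inl, Sum.elim_inr]
      rw [← Finset.sum_add_distrib, ← hsum i, Finset.sum_div]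
      refine Finset.sum_congr rfl fun j _ => ?_
      ring
  have hrc : (r : ℂ) ≠ 0 := by exact_mod_cast hr0.ne'
  constructor
  · intro i j hij
    have := key i (Sum.inl j) (Finset.mem_univ _) hij
    simpa [div_left_inj' hrc] using this
  · intro i j hij
    have := key i (Sum.inr j) (Finset.mem_univ _) hij
    simpa [div_left_inj' hrc] using this

/-- At `θ = 0` each step of a walk multiplies the entry by `μ`. If `(A + B) ^ k` is positive, walks
of length `k` lead from `i` both to `i` and to `j`, so both entries equal `μ ^ k * x i`. -/
theorem eq_of_map_mulVec_eq {x : ι → ℂ} {μ : ℂ} (hx : x ≠ 0) (hμ : 1 ≤ ‖μ‖)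
    (he : (A + B).map ((↑) : ℝ → ℂ) *ᵥ x = μ • x) (i j : ι) : x i = x j := by
  rw [← tilt_zero] at he
  obtain ⟨⟨r, hr, hxr⟩, hμ1, h1, h2⟩ := h.phase_of_eigenvector (θ := 0) hx hμ (by simpa using he)
  have hstep : ∀ i j, 0 < (A + B) i j → x j = μ * x i := by
    intro i j hij
    rcases (h.A_nonneg i j).lt_or_eq with ha | ha
    · simpa using h1 i j ha
    · refine h2 i j ?_
      simpa [← ha] using hij
  have hpow : ∀ n : ℕ, ∀ i j, 0 < ((A + B) ^ n) i j → x j = μ ^ n * x i := by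
    intro n
    induction n with
    | zero =>
      intro i j hij
      rcases eq_or_ne i j with rfl | hne
      · simp
      · simp [Matrix.one_apply_ne hne] at hij
    | succ n ih =>
      intro i j hij
      rw [pow_succ, Matrix.mul_apply] at hij
      obtain ⟨l, -, hl⟩ := Finset.exists_lt_of_sum_lt (s := Finset.univ) (f := fun _ => (0 : ℝ))
        (by simpa using hij)
      rw [hstep l j ((h.add_nonneg' l j).lt_of_ne' (right_ne_zero_of_mul hl.ne')),
        ih i l ((h.pow_nonneg' n i l).lt_of_ne' (left_ne_zero_of_mul hl.ne'))]
      ring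
  obtain ⟨k, -, hk⟩ := h.primitive.exists_pos_pow
  rw [hpow k i i (hk i i), ← hpow k i j (hk i j)]

end

/-- Invariant probability vector of the stochastic matrix `A + B`. -/
structure IsStationary (A B : Matrix ι ι ℝ) (p : ι → ℝ) : Prop where
  pos : ∀ i, 0 < p i
  sum_eq_one : ∑ i, p i = 1
  vecMul_eq : p ᵥ* (A + B) = p

section
variable (h : IsStochasticPair A B)
include h

/-- The eigenvalue 1 also has a left eigenvector. Its absolute values are subinvariant, and equal
total mass turns this into invariance; a positive power gives positivity. -/
theorem exists_isStationary [Nonempty ι] : ∃ p, IsStationary A B p := by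
  have hdet : (A + B - 1).det = 0 := by
    rw [← Matrix.exists_mulVec_eq_zero_iff]
    exact ⟨1, one_ne_zero, by rw [Matrix.sub_mulVec, h.mulVec_one, Matrix.one_mulVec, sub_self]⟩
  obtain ⟨y, hy0, hy⟩ := Matrix.exists_vecMul_eq_zero_iff.2 hdet
  rw [Matrix.vecMul_sub, Matrix.vecMul_one, sub_eq_zero] at hy
  have hle : ∀ j ∈ Finset.univ, |y j| ≤ ((fun i => |y i|) ᵥ* (A + B)) j := by
    intro j _
    conv_lhs => rw [← hy]
    refine (Finset.abs_sum_le_sum_abs _ _).trans (Finset.sum_le_sum fun i _ => ?_)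
    rw [abs_mul, abs_of_nonneg (h.add_nonneg' i j)]
  have hs : ∑ j, ((fun i => |y i|) ᵥ* (A + B)) j = ∑ j, |y j| := by
    simp only [Matrix.vecMul, dotProduct]
    rw [Finset.sum_comm]
    refine Finset.sum_congr rfl fun i _ => ?_
    rw [← Finset.mul_sum, h.sum_row, mul_one]
  have heq := (Finset.sum_eq_sum_iff_of_le hle).1 hs.symm
  have hinv : (fun i => |y i|) ᵥ* (A + B) = fun i => |y i| :=
    funext fun j => (heq j (Finset.mem_univ j)).symm
  have hinvn : ∀ n : ℕ, (fun i => |y i|) ᵥ* (A + B) ^ n = fun i => |y i| := by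
    intro n
    induction n with
    | zero => simp
    | succ n ih => rw [pow_succ, ← Matrix.vecMul_vecMul, ih, hinv]
  obtain ⟨i₀, hi₀⟩ : ∃ i, y i ≠ 0 := by
    by_contra! hc; exact hy0 (funext hc)
  obtain ⟨k, -, hk⟩ := h.primitive.exists_pos_pow
  have hpos : ∀ j, 0 < |y j| := by
    intro j
    rw [← congrFun (hinvn k) j]
    exact Finset.sum_pos' (fun i _ => mul_nonneg (abs_nonneg _) (hk i j).le)
      ⟨i₀, Finset.mem_univ _, mul_pos (abs_pos.2 hi₀) (hk i₀ j)⟩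
  have hS : 0 < ∑ j, |y j| := Finset.sum_pos (fun j _ => hpos j) Finset.univ_nonempty
  refine ⟨(∑ j, |y j|)⁻¹ • fun i => |y i|, fun i => ?_, ?_, ?_⟩
  · simp only [Pi.smul_apply, smul_eq_mul]
    have := hpos i
    positivity
  · simp only [Pi.smul_apply, smul_eq_mul, ← Finset.mul_sum]
    exact inv_mul_cancel₀ hS.ne'
  · rw [Matrix.smul_vecMul, hinv]

/-- Subtracting the projection onto constants removes the only peripheral eigenvalue: an eigenvector
with `1 ≤ ‖μ‖` is annihilated by `p`, so it is an eigenvector of `A + B`, hence constant, hence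
zero. -/
theorem norm_lt_one_of_mem_spectrum_sub {p : ι → ℝ} (hp : IsStationary A B p) {μ : ℂ}
    (hμ : μ ∈ spectrum ℂ ((A + B).map ((↑) : ℝ → ℂ)
      - Matrix.vecMulVec (1 : ι → ℂ) (fun i => (p i : ℂ)))) : ‖μ‖ < 1 := by
  by_contra! hc
  obtain ⟨x, hx, he⟩ := Matrix.exists_mulVec_eq_smul_of_mem_spectrum hμ
  have hμ0 : μ ≠ 0 := by rintro rfl; simp at hc; linarith
  have hpP : (fun i => (p i : ℂ)) ᵥ* (A + B).map ((↑) : ℝ → ℂ) = fun i => (p i : ℂ) := by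
    ext j
    have := congrFun hp.vecMul_eq j
    simp only [Matrix.vecMul, dotProduct, Matrix.map_apply] at this ⊢
    exact_mod_cast this
  have hp1 : (fun i => (p i : ℂ)) ⬝ᵥ (1 : ι → ℂ) = 1 := by
    have := hp.sum_eq_one
    simp only [dotProduct, Pi.one_apply, mul_one]
    exact_mod_cast this
  have hpx : (fun i => (p i : ℂ)) ⬝ᵥ x = 0 := by
    have h1 := congrArg (fun v => (fun i => (p i : ℂ)) ⬝ᵥ v) he
    simp only [Matrix.sub_mulVec, dotProduct_sub, Matrix.dotProduct_mulVec, hpP,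
      Matrix.vecMul_vecMulVec, hp1, one_smul, dotProduct_smul, smul_eq_mul, sub_self] at h1
    exact (mul_eq_zero.1 h1.symm).resolve_left hμ0
  have he' : (A + B).map ((↑) : ℝ → ℂ) *ᵥ x = μ • x := by
    rw [← he, Matrix.sub_mulVec, Matrix.vecMulVec_mulVec, hpx]
    simp
  have hconst := h.eq_of_map_mulVec_eq hx hc he'
  apply hx
  ext i
  have : (fun i => (p i : ℂ)) ⬝ᵥ x = x i * ((fun i => (p i : ℂ)) ⬝ᵥ (1 : ι → ℂ)) := by
    simp only [dotProduct, Finset.mul_sum, Pi.one_apply, mul_one]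
    refine Finset.sum_congr rfl fun j _ => ?_
    rw [hconst j i, mul_comm]
  rw [hp1, hpx, mul_one] at this
  simpa using this.symm

end
end IsStochasticPair

/-! ### Aperiodicity read along closed walks -/

namespace LinRep

variable {ι : Type*} {R : LinRep ι}

theorem IsWalk.pow_count_mul {c μ : ℂ} {x : ι → ℂ}
    (hA : ∀ i j, 0 < R.A i j → c * x j = μ * x i) (hB : ∀ i j, 0 < R.B i j → x j = μ * x i)
    {i j : ι} {w : List Bool} (hw : R.IsWalk i w j) :
    c ^ w.count true * x j = μ ^ w.length * x i := by
  induction hw with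
  | nil i => simp
  | @cons i j k a w ha hw ih =>
    cases a
    · have := hB i j (by simpa [letterMatrix] using ha)
      rw [List.count_cons_of_ne (by simp), ih, this, List.length_cons]
      ring
    · have := hA i j (by simpa [letterMatrix] using ha)
      rw [List.count_cons_self, pow_succ', mul_assoc, ih, List.length_cons, mul_left_comm, this]
      ring

theorem IsWalk.count_add_sub {b : ℝ} {g : ι → ℝ}
    (hA : ∀ i j, 0 < R.A i j → 1 + g j - g i = b) (hB : ∀ i j, 0 < R.B i j → g j - g i = b)
    {i j : ι} {w : List Bool} (hw : R.IsWalk i w j) :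
    w.count true + g j - g i = b * w.length := by
  induction hw with
  | nil i => simp
  | @cons i j k a w ha hw ih =>
    cases a
    · have := hB i j (by simpa [letterMatrix] using ha)
      rw [List.count_cons_of_ne (by simp), List.length_cons]
      push_cast
      linarith
    · have := hA i j (by simpa [letterMatrix] using ha)
      rw [List.count_cons_self, List.length_cons]
      push_cast
      linarith

/-- On a cycle the entry of `x` cancels, so `c ^ count` depends on the length only. The order of `c`
therefore divides every cycle difference; infinite order, encoded as 0, is covered too. -/
theorem AperiodicPair.eq_one (h : R.AperiodicPair) {c μ : ℂ} {x : ι → ℂ} (hc : c ≠ 0)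
    (hx : ∀ i, x i ≠ 0) (hA : ∀ i j, 0 < R.A i j → c * x j = μ * x i)
    (hB : ∀ i j, 0 < R.B i j → x j = μ * x i) : c = 1 := by
  have hcyc : ∀ w, R.IsCycleLabel w → c ^ w.count true = μ ^ w.length := by
    rintro w ⟨-, i, hi⟩
    exact mul_right_cancel₀ (hx i) (hi.pow_count_mul hA hB)
  have h1 : orderOf (Units.mk0 c hc) = 1 := by
    apply h
    rintro d ⟨w₁, w₂, h1, h2, hlen, rfl⟩
    rw [orderOf_dvd_iff_zpow_eq_one, zpow_sub, mul_inv_eq_one]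
    ext
    simp only [zpow_natCast, Units.val_pow_eq_pow_val, Units.val_mk0]
    rw [hcyc _ h1, hcyc _ h2, hlen]
  rw [orderOf_eq_one_iff] at h1
  simpa using congrArg Units.val h1

theorem AperiodicPair.not_forall_eq (h : R.AperiodicPair) {b : ℝ} {g : ι → ℝ} :
    ¬ ((∀ i j, 0 < R.A i j → 1 + g j - g i = b) ∧ ∀ i j, 0 < R.B i j → g j - g i = b) := by
  rintro ⟨hA, hB⟩
  have hcyc : ∀ w, R.IsCycleLabel w → (w.count true : ℝ) = b * w.length := by
    rintro w ⟨-, i, hi⟩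
    linarith [hi.count_add_sub hA hB]
  -- Counts proportional to length make all cycle differences vanish, so 0 divides them all.
  refine zero_ne_one (h 0 ?_)
  rintro d ⟨w₁, w₂, h1, h2, hlen, rfl⟩
  have : (w₁.count true : ℝ) = w₂.count true := by rw [hcyc _ h1, hcyc _ h2, hlen]
  have : w₁.count true = w₂.count true := by exact_mod_cast this
  simp [this]

theorem norm_lt_one_of_mem_spectrum_tilt [Fintype ι] [DecidableEq ι]
    (hs : IsStochasticPair R.A R.B) (h : R.AperiodicPair) {θ : ℝ} (hθ0 : θ ≠ 0)
    (hθ : |θ| ≤ Real.pi) {μ : ℂ} (hμ : μ ∈ spectrum ℂ (tilt R.A R.B (θ * Complex.I))) :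
    ‖μ‖ < 1 := by
  by_contra! hc
  obtain ⟨x, hx, he⟩ := Matrix.exists_mulVec_eq_smul_of_mem_spectrum hμ
  obtain ⟨⟨r, hr, hxr⟩, -, hA, hB⟩ := hs.phase_of_eigenvector hx hc he
  have h1 := h.eq_one (Complex.exp_ne_zero _)
    (fun i => norm_pos_iff.1 (by rw [hxr]; exact hr)) hA hB
  rw [Complex.exp_eq_one_iff] at h1
  obtain ⟨n, hn⟩ := h1
  have h2 : θ = n * (2 * Real.pi) := by
    have := congrArg Complex.im hn
    simpa using this
  have hn0 : n ≠ 0 := by rintro rfl; simp at h2; exact hθ0 h2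
  have hn1 : (1 : ℝ) ≤ |(n : ℝ)| := by exact_mod_cast Int.one_le_abs hn0
  rw [h2, abs_mul, abs_of_pos (by positivity : 0 < 2 * Real.pi)] at hθ
  nlinarith [Real.pi_pos]

end LinRep

/-! ### Analytic eigenvectors and the variance formula -/

/-- Factor `S = G (1 - G⁻¹ e pᵀ)`; by the matrix determinant lemma the second factor has determinant
`1 - p ⬝ᵥ G⁻¹ e`. A singular matrix thus gets eigenvectors given by an explicit formula. -/
theorem Matrix.eigenvectors_of_det_eq_zero {ι : Type*} [Fintype ι] [DecidableEq ι]
    {S G : Matrix ι ι ℂ} {e p : ι → ℂ} (hGS : G = S + Matrix.vecMulVec e p) (hG : IsUnit G.det)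
    (hS : S.det = 0) :
    p ⬝ᵥ (G⁻¹ *ᵥ e) = 1 ∧ S *ᵥ (G⁻¹ *ᵥ e) = 0 ∧ (p ᵥ* G⁻¹) ᵥ* S = 0 := by
  have hS' : S = G * (1 - Matrix.vecMulVec (G⁻¹ *ᵥ e) p) := by
    rw [mul_sub, mul_one, Matrix.mul_vecMulVec, Matrix.mulVec_mulVec, Matrix.mul_nonsing_inv _ hG,
      Matrix.one_mulVec, hGS, add_sub_cancel_right]
  have hp : p ⬝ᵥ (G⁻¹ *ᵥ e) = 1 := by
    have h1 : (1 - Matrix.vecMulVec (G⁻¹ *ᵥ e) p).det = 1 - p ⬝ᵥ (G⁻¹ *ᵥ e) := by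
      rw [sub_eq_add_neg, ← Matrix.neg_vecMulVec, Matrix.vecMulVec_eq Unit,
        Matrix.det_one_add_replicateCol_mul_replicateRow, dotProduct_neg, sub_eq_add_neg]
    rw [hS', Matrix.det_mul, h1] at hS
    have := (mul_eq_zero.1 hS).resolve_left hG.ne_zero
    exact (sub_eq_zero.1 this).symm
  have hSG : S = G - Matrix.vecMulVec e p := by rw [hGS, add_sub_cancel_right]
  refine ⟨hp, ?_, ?_⟩
  · rw [hSG, Matrix.sub_mulVec, Matrix.mulVec_mulVec, Matrix.mul_nonsing_inv _ hG,
      Matrix.vecMulVec_mulVec, hp]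
    simp
  · rw [hSG, Matrix.vecMul_sub, Matrix.vecMul_vecMul, Matrix.nonsing_inv_mul _ hG,
      Matrix.vecMul_vecMulVec, ← Matrix.dotProduct_mulVec, hp]
    simp

/-- `X` is a spectral projection of `T`, and `T - c • X` annihilates it, so no cross terms survive.
At `n = 0` the right side would be `X + 1`. -/
theorem pow_eq_smul_add_sub_pow {𝔸 : Type*} [Ring 𝔸] [Algebra ℂ 𝔸] {T X : 𝔸} {c : ℂ}
    (h1 : T * X = c • X) (h2 : X * T = c • X) (h3 : X * X = X) {n : ℕ} (hn : 1 ≤ n) :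
    T ^ n = c ^ n • X + (T - c • X) ^ n := by
  induction n, hn using Nat.le_induction with
  | base => simp
  | succ n hn ih =>
    have h4 : (T - c • X) * X = 0 := by
      rw [sub_mul, h1, smul_mul_assoc, h3, sub_self]
    have h5 : (T - c • X) ^ n * X = 0 := by
      obtain ⟨m, rfl⟩ := Nat.exists_eq_add_of_le' hn
      rw [pow_succ, mul_assoc, h4, mul_zero]
    rw [pow_succ, ih, add_mul, smul_mul_assoc, h2, pow_succ (T - c • X), mul_sub, mul_smul_comm, h5,
      smul_zero, sub_zero, pow_succ, smul_smul]

theorem analyticAt_tilt {ι : Type*} [Fintype ι] [DecidableEq ι] (A B : Matrix ι ι ℝ) (z : ℂ) :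
    AnalyticAt ℂ (tilt A B) z := by
  unfold tilt
  fun_prop

namespace IsStochasticPair

variable {ι : Type*} [Fintype ι] [DecidableEq ι] {A B : Matrix ι ι ℝ}

theorem isUnit_one_sub (h : IsStochasticPair A B) {p : ι → ℝ} (hp : IsStationary A B p) :
    IsUnit ((1 : Matrix ι ι ℂ) - ((A + B).map ((↑) : ℝ → ℂ)
      - Matrix.vecMulVec (1 : ι → ℂ) (fun i => (p i : ℂ)))) := by
  by_contra hc
  have : (1 : ℂ) ∈ spectrum ℂ ((A + B).map ((↑) : ℝ → ℂ)
      - Matrix.vecMulVec (1 : ι → ℂ) (fun i => (p i : ℂ))) := by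
    rw [spectrum.mem_iff]
    simpa using hc
  simpa using h.norm_lt_one_of_mem_spectrum_sub hp this

theorem IsStationary.dotProduct_one {p : ι → ℝ} (hp : IsStationary A B p) :
    (fun i => (p i : ℂ)) ⬝ᵥ (1 : ι → ℂ) = 1 := by
  have := hp.sum_eq_one
  simp only [dotProduct, Pi.one_apply, mul_one]
  exact_mod_cast this

theorem IsStationary.vecMul_map {p : ι → ℝ} (hp : IsStationary A B p) :
    (fun i => (p i : ℂ)) ᵥ* (A + B).map ((↑) : ℝ → ℂ) = fun i => (p i : ℂ) := by
  ext j
  have := congrFun hp.vecMul_eq j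
  simp only [Matrix.vecMul, dotProduct, Matrix.map_apply] at this ⊢
  exact_mod_cast this

theorem map_mulVec_one (h : IsStochasticPair A B) :
    (A + B).map ((↑) : ℝ → ℂ) *ᵥ 1 = 1 := by
  ext i
  have := h.sum_row i
  simp only [Matrix.mulVec, dotProduct, Matrix.map_apply, Pi.one_apply, mul_one]
  exact_mod_cast this

/-- The rank-one perturbation `G` of `u - tilt` is invertible at 0, hence nearby, and inversion is
analytic; `G⁻¹ 1` and `p G⁻¹` are the eigenvectors. -/
theorem exists_analytic_eigenvectors (h : IsStochasticPair A B) {p : ι → ℝ}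
    (hp : IsStationary A B p) {u : ℂ → ℂ} (hu : AnalyticAt ℂ u 0) (hu0 : u 0 = 1)
    (hdet : ∀ᶠ z in 𝓝 (0 : ℂ), (u z • (1 : Matrix ι ι ℂ) - tilt A B z).det = 0) :
    ∃ w y : ℂ → ι → ℂ, AnalyticAt ℂ w 0 ∧ AnalyticAt ℂ y 0 ∧ w 0 = 1 ∧
      (y 0 = fun i => (p i : ℂ)) ∧
      ∀ᶠ z in 𝓝 (0 : ℂ), (fun i => (p i : ℂ)) ⬝ᵥ w z = 1 ∧ tilt A B z *ᵥ w z = u z • w z ∧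
        y z ᵥ* tilt A B z = u z • y z := by
  set q : ι → ℂ := fun i => (p i : ℂ) with hq
  set G : ℂ → Matrix ι ι ℂ := fun z => u z • 1 - tilt A B z + Matrix.vecMulVec 1 q with hG
  have hGa : AnalyticAt ℂ G 0 := by
    have := analyticAt_tilt A B 0
    fun_prop
  have hG0 : G 0 = 1 - ((A + B).map ((↑) : ℝ → ℂ) - Matrix.vecMulVec 1 q) := by
    simp only [hG, hu0, tilt_zero, one_smul]; abel
  have hunit0 : IsUnit (G 0) := hG0 ▸ h.isUnit_one_sub hp
  have hunit : ∀ᶠ z in 𝓝 (0 : ℂ), IsUnit (G z) :=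
    hGa.continuousAt.eventually (Units.isOpen.mem_nhds hunit0)
  have hinv : AnalyticAt ℂ (fun z => (G z)⁻¹) 0 := by
    have : (fun z => (G z)⁻¹) = fun z => Ring.inverse (G z) := by
      ext1 z; rw [Matrix.nonsing_inv_eq_ringInverse]
    rw [this]
    obtain ⟨U, hU⟩ := hunit0
    have := analyticAt_inverse (𝕜 := ℂ) U
    rw [hU] at this
    exact this.comp hGa
  have hu0' : IsUnit (G 0).det := (Matrix.isUnit_iff_isUnit_det _).1 hunit0
  refine ⟨fun z => (G z)⁻¹ *ᵥ 1, fun z => q ᵥ* (G z)⁻¹, ?_, ?_, ?_, ?_, ?_⟩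
  · let L : Matrix ι ι ℂ →ₗ[ℂ] (ι → ℂ) := (Matrix.mulVecBilin ℂ ℂ).flip 1
    exact (LinearMap.toContinuousLinearMap L).analyticAt _ |>.comp hinv
  · let L : Matrix ι ι ℂ →ₗ[ℂ] (ι → ℂ) := Matrix.vecMulBilin ℂ ℂ q
    exact (LinearMap.toContinuousLinearMap L).analyticAt _ |>.comp hinv
  · have : G 0 *ᵥ 1 = 1 := by
      rw [hG0, Matrix.sub_mulVec, Matrix.sub_mulVec, h.map_mulVec_one, Matrix.vecMulVec_mulVec,
        hp.dotProduct_one]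
      simp
    conv_lhs => rw [← this]
    simp only [Matrix.mulVec_mulVec, Matrix.nonsing_inv_mul _ hu0', Matrix.one_mulVec]
  · have : q ᵥ* G 0 = q := by
      rw [hG0, Matrix.vecMul_sub, Matrix.vecMul_sub, hp.vecMul_map, Matrix.vecMul_vecMulVec,
        hp.dotProduct_one]
      simp [hq]
    conv_lhs => rw [← this]
    simp only [Matrix.vecMul_vecMul, Matrix.mul_nonsing_inv _ hu0', Matrix.vecMul_one]
  · filter_upwards [hunit, hdet] with z h1 h2
    obtain ⟨a, b, c⟩ := Matrix.eigenvectors_of_det_eq_zero (G := G z) rfl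
      ((Matrix.isUnit_iff_isUnit_det _).1 h1) h2
    refine ⟨a, ?_, ?_⟩
    · rw [Matrix.sub_mulVec, Matrix.smul_mulVec, Matrix.one_mulVec, sub_eq_zero] at b
      exact b.symm
    · rw [Matrix.vecMul_sub, Matrix.vecMul_smul, Matrix.vecMul_one, sub_eq_zero] at c
      exact c.symm

/-- After expanding the squares, the Poisson equation `hg` removes the terms linear in `(A + B) g`,
and invariance of `p` cancels those in `g ^ 2`. -/
theorem sum_sq_eq (h : IsStochasticPair A B) {p : ι → ℝ} (hp : IsStationary A B p) {b : ℝ}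
    {g : ι → ℝ} (hb : b = ∑ i, p i * ∑ j, A i j) (hpg : ∑ i, p i * g i = 0)
    (hg : ∀ i, ∑ j, A i j + ∑ j, (A + B) i j * g j = b + g i) :
    ∑ i, p i * ∑ j, (A i j * (1 + (g j - g i - b)) ^ 2 + B i j * (g j - g i - b) ^ 2)
      = b + 2 * (∑ i, p i * ∑ j, A i j * g j) - b ^ 2 := by
  have hrow : ∀ i, ∑ j, (A i j * (1 + (g j - g i - b)) ^ 2 + B i j * (g j - g i - b) ^ 2)
      = ∑ j, A i j + 2 * (∑ j, A i j * g j) + ∑ j, (A + B) i j * g j ^ 2 - (g i + b) ^ 2 := by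
    intro i
    have h1 : ∑ j, (A i j * (1 + (g j - g i - b)) ^ 2 + B i j * (g j - g i - b) ^ 2)
        = ∑ j, A i j * (1 - 2 * (g i + b)) + 2 * (∑ j, A i j * g j)
          + ∑ j, (A + B) i j * g j ^ 2 - 2 * (g i + b) * (∑ j, (A + B) i j * g j)
          + (g i + b) ^ 2 * ∑ j, (A + B) i j := by
      simp only [Finset.mul_sum, ← Finset.sum_add_distrib, ← Finset.sum_sub_distrib]
      refine Finset.sum_congr rfl fun j _ => ?_
      simp only [Matrix.add_apply]
      ring
    have h2 : ∑ j, (A + B) i j * g j = b + g i - ∑ j, A i j := by linarith [hg i]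
    rw [h1, h.sum_row, h2, ← Finset.sum_mul]
    ring
  have hsq : ∑ i, p i * ∑ j, (A + B) i j * g j ^ 2 = ∑ j, p j * g j ^ 2 := by
    simp only [Finset.mul_sum]
    rw [Finset.sum_comm]
    refine Finset.sum_congr rfl fun j _ => ?_
    have := congrFun hp.vecMul_eq j
    simp only [Matrix.vecMul, dotProduct] at this
    conv_rhs => rw [← this]
    rw [Finset.sum_mul]
    simp only [mul_assoc]
  have h3 : ∑ i, p i * (g i + b) ^ 2 = ∑ i, p i * g i ^ 2 + b ^ 2 := by
    have : ∑ i, p i * (g i + b) ^ 2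
        = ∑ i, p i * g i ^ 2 + 2 * b * ∑ i, p i * g i + b ^ 2 * ∑ i, p i := by
      simp only [Finset.mul_sum, ← Finset.sum_add_distrib]
      exact Finset.sum_congr rfl fun j _ => by ring
    rw [this, hpg, hp.sum_eq_one]; ring
  have h4 : ∑ i, p i * (2 * ∑ j, A i j * g j) = 2 * ∑ i, p i * ∑ j, A i j * g j := by
    rw [Finset.mul_sum]
    exact Finset.sum_congr rfl fun j _ => by ring
  simp only [hrow, mul_add, mul_sub, Finset.sum_add_distrib, Finset.sum_sub_distrib, hsq, h3, h4,
    ← hb]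
  ring

/-- Pairing the eigenvalue equation with `p` gives `u = 1 + (e^z - 1) φ` with `φ = p A w`, so `u'(0)
= φ(0)` and `u''(0) = φ(0) + 2 φ'(0)`. The function `g` is `w'(0)`, and differentiating the
eigenvalue equation at 0 is its Poisson equation. -/
theorem exists_moments (h : IsStochasticPair A B) {p : ι → ℝ}
    (hp : IsStationary A B p) {u : ℂ → ℂ} (hu : AnalyticAt ℂ u 0) (hu0 : u 0 = 1)
    (hdet : ∀ᶠ z in 𝓝 (0 : ℂ), (u z • (1 : Matrix ι ι ℂ) - tilt A B z).det = 0) :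
    ∃ (b : ℝ) (g : ι → ℝ), deriv u 0 = b ∧ iteratedDeriv 2 u 0 - deriv u 0 ^ 2 =
      ((∑ i, p i * ∑ j, (A i j * (1 + (g j - g i - b)) ^ 2 + B i j * (g j - g i - b) ^ 2) : ℝ)
        : ℂ) := by
  obtain ⟨w, y, hw, -, hw0, -, hev⟩ := h.exists_analytic_eigenvectors hp hu hu0 hdet
  set q : ι → ℂ := fun i => (p i : ℂ) with hq
  set b : ℝ := ∑ i, p i * ∑ j, A i j with hb
  set G : ι → ℂ := deriv w 0 with hG
  have hwd : HasDerivAt w G 0 := hw.differentiableAt.hasDerivAt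
  have hwi : ∀ i, HasDerivAt (fun z => w z i) (G i) 0 := fun i => hasDerivAt_pi.1 hwd i
  set φ : ℂ → ℂ := fun z => ∑ i, q i * ∑ j, (A i j : ℂ) * w z j with hφ
  have hφa : AnalyticAt ℂ φ 0 := by
    have : ∀ j, AnalyticAt ℂ (fun z => w z j) 0 := analyticAt_pi_iff.1 hw
    have h1 : ∀ i, AnalyticAt ℂ (fun z => ∑ j, (A i j : ℂ) * w z j) 0 := fun i =>
      Finset.analyticAt_fun_sum _ fun j _ => analyticAt_const.mul (this j)
    exact Finset.analyticAt_fun_sum _ fun i _ => analyticAt_const.mul (h1 i)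
  have hφ0 : φ 0 = b := by
    simp only [hφ, hw0, hb, hq, Pi.one_apply, mul_one]
    push_cast; rfl
  have hφd : deriv φ 0 = ∑ i, q i * ∑ j, (A i j : ℂ) * G j := by
    apply HasDerivAt.deriv
    exact HasDerivAt.fun_sum fun i _ => HasDerivAt.const_mul _ <|
      HasDerivAt.fun_sum fun j _ => (hwi j).const_mul _
  have hueq : u =ᶠ[𝓝 0] fun z => 1 + (Complex.exp z - 1) * φ z := by
    filter_upwards [hev] with z ⟨h1, h2, h3⟩
    have h4 : q ⬝ᵥ (tilt A B z *ᵥ w z) = u z := by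
      rw [h2, dotProduct_smul, h1, smul_eq_mul, mul_one]
    have h5 : tilt A B z = (Complex.exp z - 1) • A.map ((↑) : ℝ → ℂ)
        + (A + B).map ((↑) : ℝ → ℂ) := by
      ext i j; simp [tilt]; ring
    rw [← h4, h5, Matrix.add_mulVec, dotProduct_add, Matrix.dotProduct_mulVec q (Matrix.map _ _),
      hp.vecMul_map, h1, Matrix.smul_mulVec, dotProduct_smul, smul_eq_mul, add_comm]
    rfl
  have hd1 : deriv u =ᶠ[𝓝 0] fun z => Complex.exp z * φ z + (Complex.exp z - 1) * deriv φ z := by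
    refine hueq.deriv.trans ?_
    filter_upwards [hφa.eventually_analyticAt] with z hz
    have := (((Complex.hasDerivAt_exp z).sub_const 1).mul hz.differentiableAt.hasDerivAt).const_add 1
    exact this.deriv
  have hu1 : deriv u 0 = b := by rw [hd1.self_of_nhds]; simp [hφ0]
  have hu2 : iteratedDeriv 2 u 0 = b + 2 * ∑ i, q i * ∑ j, (A i j : ℂ) * G j := by
    rw [iteratedDeriv_succ, iteratedDeriv_one, hd1.deriv_eq]
    have := ((Complex.hasDerivAt_exp 0).mul hφa.differentiableAt.hasDerivAt).add
      (((Complex.hasDerivAt_exp 0).sub_const 1).mul hφa.deriv.differentiableAt.hasDerivAt)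
    rw [show deriv (fun z => Complex.exp z * φ z + (Complex.exp z - 1) * deriv φ z) 0 = _
      from this.deriv, hφd, hφ0]
    simp
    ring
  have hpoisson : ∀ i, ∑ j, (A i j : ℂ) + ∑ j, ((A i j : ℂ) + B i j) * G j = b + G i := by
    intro i
    have e1 : (fun z => ∑ j, (Complex.exp z * A i j + B i j) * w z j)
        =ᶠ[𝓝 0] fun z => u z * w z i := by
      filter_upwards [hev] with z ⟨_, h2, _⟩
      have := congrFun h2 i
      simpa [Matrix.mulVec, dotProduct, tilt_apply] using this
    have d1 : HasDerivAt (fun z => ∑ j, (Complex.exp z * A i j + B i j) * w z j)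
        (∑ j, (Complex.exp 0 * A i j * w 0 j + (Complex.exp 0 * A i j + B i j) * G j)) 0 :=
      HasDerivAt.fun_sum fun j _ =>
        (((Complex.hasDerivAt_exp 0).mul_const _).add_const _).mul (hwi j)
    have d2 : HasDerivAt (fun z => u z * w z i) (deriv u 0 * w 0 i + u 0 * G i) 0 :=
      hu.differentiableAt.hasDerivAt.mul (hwi i)
    have := (d1.congr_of_eventuallyEq e1.symm).unique d2
    simpa [hw0, hu0, hu1, Finset.sum_add_distrib] using this
  have hqG : ∑ i, q i * G i = 0 := by
    have e1 : (fun z => ∑ i, q i * w z i) =ᶠ[𝓝 0] fun _ => 1 := by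
      filter_upwards [hev] with z ⟨h1, _, _⟩ using h1
    have d1 : HasDerivAt (fun z => ∑ i, q i * w z i) (∑ i, q i * G i) 0 :=
      HasDerivAt.fun_sum fun i _ => (hwi i).const_mul _
    exact (d1.congr_of_eventuallyEq e1.symm).unique (hasDerivAt_const _ _)
  have hre : ∑ i, p i * (G i).re = 0 := by
    have := congrArg Complex.re hqG
    simpa [hq] using this
  have him : ∑ i, p i * (G i).im = 0 := by
    have := congrArg Complex.im hqG
    simpa [hq] using this
  have hPre : ∀ i, ∑ j, A i j + ∑ j, (A + B) i j * (G j).re = b + (G i).re := by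
    intro i
    have := congrArg Complex.re (hpoisson i)
    simpa using this
  have hPim : ∀ i, ∑ j, (A + B) i j * (G j).im = (G i).im := by
    intro i
    have := congrArg Complex.im (hpoisson i)
    simpa using this
  -- The imaginary part is harmonic, hence constant, and its mean under `p` is zero.
  have him0 : ∀ i, (G i).im = 0 := by
    intro i
    have hc := h.eq_of_le_mulVec (y := fun i => (G i).im) fun i => (hPim i).ge
    have : ∑ j, p j * (G j).im = (∑ j, p j) * (G i).im := by
      rw [Finset.sum_mul]
      exact Finset.sum_congr rfl fun j _ => by rw [show (G j).im = (G i).im from hc j i]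
    rw [him, hp.sum_eq_one, one_mul] at this
    exact this.symm
  have hGre : ∀ i, G i = ((G i).re : ℂ) := fun i => Complex.ext rfl (by simp [him0])
  refine ⟨b, fun i => (G i).re, hu1, ?_⟩
  rw [h.sum_sq_eq (b := b) hp hb hre hPre, hu2, hu1]
  have : ∑ i, q i * ∑ j, (A i j : ℂ) * G j
      = ((∑ i, p i * ∑ j, A i j * (G j).re : ℝ) : ℂ) := by
    push_cast
    simp only [← hGre]; rfl
  rw [this]
  push_cast
  ring

end IsStochasticPair

theorem LinRep.AperiodicPair.sum_sq_pos {ι : Type*} [Fintype ι] [DecidableEq ι] {R : LinRep ι}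
    (h : R.AperiodicPair) {p g : ι → ℝ} (hp : ∀ i, 0 < p i) (b : ℝ) :
    0 < ∑ i, p i * ∑ j, (R.A i j * (1 + (g j - g i - b)) ^ 2 + R.B i j * (g j - g i - b) ^ 2) := by
  have hA : ∀ i j, 0 ≤ R.A i j * (1 + (g j - g i - b)) ^ 2 := fun i j =>
    mul_nonneg (R.A_nonneg i j) (sq_nonneg _)
  have hB : ∀ i j, 0 ≤ R.B i j * (g j - g i - b) ^ 2 := fun i j =>
    mul_nonneg (R.B_nonneg i j) (sq_nonneg _)
  have hrow : ∀ i, 0 ≤ ∑ j, (R.A i j * (1 + (g j - g i - b)) ^ 2 + R.B i j * (g j - g i - b) ^ 2) :=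
    fun i => Finset.sum_nonneg fun j _ => add_nonneg (hA i j) (hB i j)
  have hi : ∀ i ∈ Finset.univ, 0 ≤ p i *
      ∑ j, (R.A i j * (1 + (g j - g i - b)) ^ 2 + R.B i j * (g j - g i - b) ^ 2) :=
    fun i _ => mul_nonneg (hp i).le (hrow i)
  refine (Finset.sum_nonneg hi).lt_of_ne' fun h0 => h.not_forall_eq (b := b) (g := g) ?_
  have h1 : ∀ i j, R.A i j * (1 + (g j - g i - b)) ^ 2 + R.B i j * (g j - g i - b) ^ 2 = 0 := by
    intro i j
    have h2 := (Finset.sum_eq_zero_iff_of_nonneg hi).1 h0 i (Finset.mem_univ i)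
    have h3 := (mul_eq_zero.1 h2).resolve_left (hp i).ne'
    exact (Finset.sum_eq_zero_iff_of_nonneg fun j _ => add_nonneg (hA i j) (hB i j)).1 h3 j
      (Finset.mem_univ j)
  constructor
  · intro i j hij
    have h2 : R.A i j * (1 + (g j - g i - b)) ^ 2 = 0 := by linarith [h1 i j, hA i j, hB i j]
    have h3 := pow_eq_zero_iff two_ne_zero |>.1 ((mul_eq_zero.1 h2).resolve_left hij.ne')
    linarith
  · intro i j hij
    have h2 : R.B i j * (g j - g i - b) ^ 2 = 0 := by linarith [h1 i j, hA i j, hB i j]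
    have h3 := pow_eq_zero_iff two_ne_zero |>.1 ((mul_eq_zero.1 h2).resolve_left hij.ne')
    linarith

/-! ### Existence of the branch and quasi-power expansion -/

namespace IsStochasticPair

variable {ι : Type*} [Fintype ι] [DecidableEq ι] {A B : Matrix ι ι ℝ}

theorem contDiff_det_sub_tilt (A B : Matrix ι ι ℝ) :
    ContDiff ℂ ⊤ fun v : ℂ × ℂ => (v.2 • (1 : Matrix ι ι ℂ) - tilt A B v.1).det := by
  simp only [Matrix.det_apply, Matrix.sub_apply, Matrix.smul_apply, tilt_apply]
  refine ContDiff.sum fun σ _ => ContDiff.const_smul _ (contDiff_prod fun i _ => ?_)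
  fun_prop

/-- Quantitative simplicity of the eigenvalue 1: with `Q` the projection, `t - P = (t - (P - Q)) (1
- t⁻¹ Q)`, which splits off the factor `(t - 1) / t` of the determinant. -/
theorem hasDerivAt_det_sub (h : IsStochasticPair A B) {p : ι → ℝ} (hp : IsStationary A B p) :
    HasDerivAt (fun t : ℂ => (t • (1 : Matrix ι ι ℂ) - tilt A B 0).det)
      ((1 : Matrix ι ι ℂ) - ((A + B).map ((↑) : ℝ → ℂ)
        - Matrix.vecMulVec (1 : ι → ℂ) (fun i => (p i : ℂ)))).det 1 := by
  set q : ι → ℂ := fun i => (p i : ℂ) with hq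
  set P : Matrix ι ι ℂ := (A + B).map ((↑) : ℝ → ℂ) with hP
  set Q : Matrix ι ι ℂ := Matrix.vecMulVec 1 q with hQ
  have hPQ : P * Q = Q := by rw [hQ, Matrix.mul_vecMulVec, h.map_mulVec_one]
  have hQQ : Q * Q = Q := by
    rw [hQ, Matrix.mul_vecMulVec, Matrix.vecMulVec_mulVec, hp.dotProduct_one]; simp
  have hfac : ∀ t : ℂ, t ≠ 0 → (t • (1 : Matrix ι ι ℂ) - tilt A B 0).det
      = (t - 1) * t⁻¹ * (t • (1 : Matrix ι ι ℂ) - (P - Q)).det := by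
    intro t ht
    have h1 : t • (1 : Matrix ι ι ℂ) - tilt A B 0 = (t • 1 - (P - Q)) * (1 - t⁻¹ • Q) := by
      have : (P - Q) * Q = 0 := by rw [sub_mul, hPQ, hQQ, sub_self]
      rw [tilt_zero, mul_sub, mul_one, mul_smul_comm, sub_mul, this, sub_zero, smul_mul_assoc,
        one_mul, smul_smul, inv_mul_cancel₀ ht, one_smul]
      abel
    have h2 : (1 - t⁻¹ • Q).det = 1 - t⁻¹ := by
      rw [hQ, sub_eq_add_neg, ← Matrix.smul_vecMulVec, ← Matrix.neg_vecMulVec,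
        Matrix.vecMulVec_eq Unit, Matrix.det_one_add_replicateCol_mul_replicateRow, dotProduct_neg,
        dotProduct_smul, hp.dotProduct_one, smul_eq_mul, mul_one, sub_eq_add_neg]
    rw [h1, Matrix.det_mul, h2]
    field_simp
  have hD : DifferentiableAt ℂ (fun t : ℂ => (t • (1 : Matrix ι ι ℂ) - (P - Q)).det) 1 := by
    simp only [Matrix.det_apply]
    fun_prop
  have hd := (((hasDerivAt_id (1 : ℂ)).sub_const 1).mul (hasDerivAt_inv one_ne_zero)).mul
    hD.hasDerivAt
  have hev : (fun t : ℂ => (t • (1 : Matrix ι ι ℂ) - tilt A B 0).det)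
      =ᶠ[𝓝 1] fun t => (t - 1) * t⁻¹ * (t • (1 : Matrix ι ι ℂ) - (P - Q)).det := by
    filter_upwards [isOpen_ne.mem_nhds (one_ne_zero : (1 : ℂ) ≠ 0)] with t ht using hfac t ht
  refine HasDerivAt.congr_of_eventuallyEq ?_ hev
  convert! hd using 1
  simp

/-- The implicit function theorem applies because the derivative in the eigenvalue is the
determinant of an invertible matrix. -/
theorem exists_branch (h : IsStochasticPair A B) [Nonempty ι] :
    ∃ u : ℂ → ℂ, AnalyticAt ℂ u 0 ∧ u 0 = 1 ∧
      ∀ᶠ z in 𝓝 (0 : ℂ), (u z • (1 : Matrix ι ι ℂ) - tilt A B z).det = 0 := by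
  obtain ⟨p, hp⟩ := h.exists_isStationary
  set F : ℂ × ℂ → ℂ := fun v => (v.2 • (1 : Matrix ι ι ℂ) - tilt A B v.1).det with hF
  have hFc : ContDiffAt ℂ ⊤ F (0, 1) := (contDiff_det_sub_tilt A B).contDiffAt
  have hd := h.hasDerivAt_det_sub hp
  set d := ((1 : Matrix ι ι ℂ) - ((A + B).map ((↑) : ℝ → ℂ)
        - Matrix.vecMulVec (1 : ι → ℂ) (fun i => (p i : ℂ)))).det with hdd
  have hd0 : d ≠ 0 := ((Matrix.isUnit_iff_isUnit_det _).1 (h.isUnit_one_sub hp)).ne_zero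
  have hchain : HasDerivAt (fun t : ℂ => F (0, t)) ((fderiv ℂ F (0, 1)) (0, 1)) 1 := by
    have h1 : HasFDerivAt F (fderiv ℂ F (0, 1)) (0, 1) :=
      (hFc.differentiableAt (by simp)).hasFDerivAt
    exact h1.comp_hasDerivAt (1 : ℂ) ((hasDerivAt_const _ _).prodMk (hasDerivAt_id _))
  have hval : (fderiv ℂ F (0, 1)) (0, 1) = d := hchain.unique hd
  have hinv : (fderiv ℂ F (0, 1) ∘L .inr ℂ ℂ ℂ).IsInvertible := by
    refine ⟨ContinuousLinearEquiv.unitsEquivAut ℂ (Units.mk0 d hd0), ?_⟩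
    ext
    simp [hval]
  refine ⟨hFc.implicitFunction (by simp) hinv, ?_, ?_, ?_⟩
  · have := hFc.contDiffAt_implicitFunction (by simp) hinv
    exact (this.of_le le_top).analyticAt
  · exact hFc.implicitFunction_apply_self (by simp) hinv
  · have hF0 : F (0, 1) = 0 := by
      have := h.mulVec_one
      simp only [hF]
      rw [← Matrix.exists_mulVec_eq_zero_iff]
      refine ⟨1, one_ne_zero, ?_⟩
      rw [tilt_zero, Matrix.sub_mulVec, h.map_mulVec_one]
      simp
    filter_upwards [hFc.eventually_apply_implicitFunction (by simp) hinv] with z hz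
    rw [hF0] at hz
    exact hz

theorem _root_.Matrix.norm_dotProduct_mulVec_le (x y : ι → ℂ) (S : Matrix ι ι ℂ) :
    ‖x ⬝ᵥ (S *ᵥ y)‖ ≤ (∑ i, ‖x i‖) * ‖y‖ * ‖S‖ := by
  refine (norm_sum_le _ _).trans ?_
  rw [mul_assoc, Finset.sum_mul]
  refine Finset.sum_le_sum fun i _ => ?_
  rw [norm_mul, mul_comm ‖y‖]
  gcongr
  exact (norm_le_pi_norm _ i).trans (Matrix.linfty_opNorm_mulVec S y)

/-- With `X` the rank-one projection built from `w` and `y`, the remainder `tilt - u • X` is at 0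
the matrix with the stationary projection removed, so its powers decay uniformly nearby. The
constant is `c = (∑ ξ) (∑ p η)`. -/
theorem exists_quasi_power [Nonempty ι] (h : IsStochasticPair A B) {u : ℂ → ℂ}
    (hu : AnalyticAt ℂ u 0) (hu0 : u 0 = 1)
    (hdet : ∀ᶠ z in 𝓝 (0 : ℂ), (u z • (1 : Matrix ι ι ℂ) - tilt A B z).det = 0)
    {ξ η : ι → ℝ} (hξ : ∀ i, 0 ≤ ξ i) (hξ0 : ξ ≠ 0) (hη : ∀ i, 0 ≤ η i) (hη0 : η ≠ 0) :
    ∃ (r : ℂ → ℂ) (c C ρ : ℝ), 0 < c ∧ r 0 = c ∧ AnalyticAt ℂ r 0 ∧ 0 ≤ C ∧ 0 ≤ ρ ∧ ρ < 1 ∧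
      ∀ᶠ z in 𝓝 (0 : ℂ), ∀ n : ℕ, 1 ≤ n →
        ‖(fun i => (ξ i : ℂ)) ⬝ᵥ (tilt A B z ^ n *ᵥ fun i => (η i : ℂ)) - r z * u z ^ n‖
          ≤ C * ρ ^ n := by
  obtain ⟨p, hp⟩ := h.exists_isStationary
  obtain ⟨w, y, hw, hy, hw0, hy0, hev⟩ := h.exists_analytic_eigenvectors hp hu hu0 hdet
  set ξ' : ι → ℂ := fun i => (ξ i : ℂ) with hξ'
  set η' : ι → ℂ := fun i => (η i : ℂ) with hη'
  have hdot : ∀ {a b : ℂ → ι → ℂ}, AnalyticAt ℂ a 0 → AnalyticAt ℂ b 0 →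
      AnalyticAt ℂ (fun z => a z ⬝ᵥ b z) 0 := by
    intro a b ha hb
    exact Finset.analyticAt_fun_sum _ fun i _ =>
      (analyticAt_pi_iff.1 ha i).mul (analyticAt_pi_iff.1 hb i)
  have hyw : AnalyticAt ℂ (fun z => y z ⬝ᵥ w z) 0 := hdot hy hw
  have hyw0 : y 0 ⬝ᵥ w 0 = 1 := by rw [hw0, hy0, hp.dotProduct_one]
  have hyw_ne : ∀ᶠ z in 𝓝 (0 : ℂ), y z ⬝ᵥ w z ≠ 0 :=
    hyw.continuousAt.eventually_ne (by rw [hyw0]; exact one_ne_zero)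
  set X : ℂ → Matrix ι ι ℂ := fun z => (y z ⬝ᵥ w z)⁻¹ • Matrix.vecMulVec (w z) (y z) with hX
  set N : ℂ → Matrix ι ι ℂ := fun z => tilt A B z - u z • X z with hN
  have hXc : ContinuousAt X 0 := by
    have h1 : ContinuousAt (fun z => (y z ⬝ᵥ w z)⁻¹) 0 :=
      hyw.continuousAt.inv₀ (by rw [hyw0]; exact one_ne_zero)
    have h2 : ContinuousAt (fun z => Matrix.vecMulVec (w z) (y z)) 0 := by
      refine continuousAt_pi.2 fun i => continuousAt_pi.2 fun j => ?_
      exact ((continuousAt_pi.1 hw.continuousAt) i).mul ((continuousAt_pi.1 hy.continuousAt) j)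
    exact h1.smul h2
  have hNc : ContinuousAt N 0 :=
    (analyticAt_tilt A B 0).continuousAt.sub (hu.continuousAt.smul hXc)
  have hN0 : N 0 = (A + B).map ((↑) : ℝ → ℂ)
      - Matrix.vecMulVec (1 : ι → ℂ) (fun i => (p i : ℂ)) := by
    simp only [hN, hX, hyw0, hu0, tilt_zero, inv_one, one_smul]
    rw [hw0, hy0]
  obtain ⟨C, ρ, hC, hρ0, hρ1, hbd⟩ := eventually_forall_norm_pow_le hNc fun μ hμ =>
    h.norm_lt_one_of_mem_spectrum_sub hp (hN0 ▸ hμ)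
  refine ⟨fun z => (y z ⬝ᵥ w z)⁻¹ * ((ξ' ⬝ᵥ w z) * (y z ⬝ᵥ η')), (∑ i, ξ i) * ∑ i, p i * η i,
    (∑ i, ‖ξ' i‖) * ‖η'‖ * C, ρ, ?_, ?_, ?_, by positivity, hρ0, hρ1, ?_⟩
  · obtain ⟨i, hi⟩ : ∃ i, ξ i ≠ 0 := by
      by_contra! hc; exact hξ0 (funext hc)
    obtain ⟨j, hj⟩ : ∃ i, η i ≠ 0 := by
      by_contra! hc; exact hη0 (funext hc)
    refine mul_pos ?_ ?_
    · exact Finset.sum_pos' (fun i _ => hξ i) ⟨i, Finset.mem_univ i, (hξ i).lt_of_ne' hi⟩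
    · exact Finset.sum_pos' (fun i _ => mul_nonneg (hp.pos i).le (hη i))
        ⟨j, Finset.mem_univ j, mul_pos (hp.pos j) ((hη j).lt_of_ne' hj)⟩
  · simp only [hyw0, inv_one, one_mul]
    simp only [hw0, hy0, dotProduct, hξ', hη', Pi.one_apply, mul_one]
    push_cast; rfl
  · exact (hyw.inv (by rw [hyw0]; exact one_ne_zero)).mul
      ((hdot analyticAt_const hw).mul (hdot hy analyticAt_const))
  · filter_upwards [hev, hyw_ne, hbd] with z ⟨_, h2, h3⟩ hne hb n hn
    have e1 : tilt A B z * X z = u z • X z := by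
      simp only [hX]
      rw [mul_smul_comm, Matrix.mul_vecMulVec, h2, Matrix.smul_vecMulVec, smul_comm]
    have e2 : X z * tilt A B z = u z • X z := by
      simp only [hX]
      rw [smul_mul_assoc, Matrix.vecMulVec_mul, h3, Matrix.vecMulVec_smul, smul_comm]
    have e3 : X z * X z = X z := by
      simp only [hX]
      rw [smul_mul_assoc, mul_smul_comm, Matrix.mul_vecMulVec, Matrix.vecMulVec_mulVec]
      rw [op_smul_eq_smul, Matrix.smul_vecMulVec, inv_smul_smul₀ hne]
    have e4 : ξ' ⬝ᵥ (X z *ᵥ η') = (y z ⬝ᵥ w z)⁻¹ * ((ξ' ⬝ᵥ w z) * (y z ⬝ᵥ η')) := by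
      simp only [hX]
      rw [Matrix.smul_mulVec, Matrix.vecMulVec_mulVec, dotProduct_smul]
      simp [mul_comm]
    rw [pow_eq_smul_add_sub_pow e1 e2 e3 hn, Matrix.add_mulVec, dotProduct_add,
      Matrix.smul_mulVec, dotProduct_smul, e4, smul_eq_mul, mul_comm _ (u z ^ n),
      add_sub_cancel_left]
    refine (Matrix.norm_dotProduct_mulVec_le _ _ _).trans ?_
    rw [mul_assoc _ C]
    gcongr
    exact hb n

end IsStochasticPair

/-! ### Gaussian approximation of the characteristic function -/

theorem norm_pow_sub_pow_le_mul {a b : ℂ} {m : ℝ} (ha : ‖a‖ ≤ m) (hb : ‖b‖ ≤ m) (n : ℕ) :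
    ‖a ^ n - b ^ n‖ ≤ n * m ^ (n - 1) * ‖a - b‖ := by
  rw [← geom_sum₂_mul, norm_mul]
  gcongr
  refine (norm_sum_le _ _).trans ?_
  have hm : 0 ≤ m := (norm_nonneg a).trans ha
  calc ∑ i ∈ Finset.range n, ‖a ^ i * b ^ (n - 1 - i)‖
      ≤ ∑ i ∈ Finset.range n, m ^ (n - 1) := by
        refine Finset.sum_le_sum fun i hi => ?_
        have : i ≤ n - 1 := Nat.le_sub_one_of_lt (Finset.mem_range.1 hi)
        calc ‖a ^ i * b ^ (n - 1 - i)‖ = ‖a‖ ^ i * ‖b‖ ^ (n - 1 - i) := by simp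
          _ ≤ m ^ i * m ^ (n - 1 - i) := by gcongr
          _ = m ^ (n - 1) := by rw [← pow_add, Nat.add_sub_cancel' this]
    _ = n * m ^ (n - 1) := by simp

theorem AnalyticAt.eventually_norm_le_cube {f : ℂ → ℂ} (hf : AnalyticAt ℂ f 0) (h0 : f 0 = 0)
    (h1 : deriv f 0 = 0) (h2 : iteratedDeriv 2 f 0 = 0) :
    ∃ C : ℝ, 0 < C ∧ ∀ᶠ z in 𝓝 (0 : ℂ), ‖f z‖ ≤ C * ‖z‖ ^ 3 := by
  have h := hf.hasFPowerSeriesAt.isBigO_sub_partialSum_pow 3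
  obtain ⟨C, hC, hb⟩ := h.exists_pos
  refine ⟨C, hC, ?_⟩
  filter_upwards [hb.bound] with z hz
  simpa [FormalMultilinearSeries.partialSum, Finset.sum_range_succ, h0, h1, h2] using hz

theorem exists_norm_sub_exp_le {u : ℂ → ℂ} (hu : AnalyticAt ℂ u 0) (hu0 : u 0 = 1) {b γ : ℝ}
    (h1 : deriv u 0 = b) (h2 : iteratedDeriv 2 u 0 - deriv u 0 ^ 2 = γ) :
    ∃ C : ℝ, 0 < C ∧ ∀ᶠ z in 𝓝 (0 : ℂ),
      ‖u z - Complex.exp (b * z + γ / 2 * z ^ 2)‖ ≤ C * ‖z‖ ^ 3 := by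
  set E : ℂ → ℂ := fun z => Complex.exp (b * z + γ / 2 * z ^ 2) with hE
  have hEd : ∀ z, HasDerivAt E (E z * (b + γ * z)) z := by
    intro z
    have := (((hasDerivAt_id z).const_mul (b : ℂ)).add
      (((hasDerivAt_id z).pow 2).const_mul ((γ : ℂ) / 2))).cexp
    convert! this using 1
    simp only [hE, Pi.add_apply, Pi.pow_apply, id_eq, mul_one]
    push_cast
    ring
  have hE1 : deriv E = fun z => E z * (b + γ * z) := funext fun z => (hEd z).deriv
  have hE0 : E 0 = 1 := by simp [hE]
  have hE2 : iteratedDeriv 2 E 0 = b ^ 2 + γ := by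
    rw [iteratedDeriv_succ, iteratedDeriv_one, hE1]
    have := (hEd 0).mul (((hasDerivAt_id (0 : ℂ)).const_mul (γ : ℂ)).const_add (b : ℂ))
    rw [show deriv (fun z => E z * (b + γ * z)) 0 = _ from this.deriv, hE0]
    simp
    ring
  have hEa : AnalyticAt ℂ E 0 := by
    simp only [hE]; fun_prop
  refine AnalyticAt.eventually_norm_le_cube (f := fun z => u z - E z) (hu.sub hEa) ?_ ?_ ?_
  · simp [hu0, hE0]
  · rw [deriv_fun_sub hu.differentiableAt hEa.differentiableAt, h1, hE1]
    simp [hE0]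
  · rw [iteratedDeriv_fun_sub hu.contDiffAt hEa.contDiffAt, hE2, ← h2, h1]
    ring

theorem norm_exp_quadratic (b γ θ : ℝ) :
    ‖Complex.exp (b * (θ * Complex.I) + γ / 2 * (θ * Complex.I) ^ 2)‖
      = Real.exp (-(γ * θ ^ 2 / 2)) := by
  rw [Complex.norm_exp]
  congr 1
  rw [mul_pow, Complex.I_sq]
  have : (b * (θ * Complex.I) + γ / 2 * (θ ^ 2 * (-1)) : ℂ)
    = ((-(γ * θ ^ 2 / 2) : ℝ) : ℂ) + ((b * θ : ℝ) : ℂ) * Complex.I := by push_cast; ring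
  rw [this, Complex.add_re, Complex.ofReal_re, Complex.re_ofReal_mul]
  simp

/-- Half of the exponential decay absorbs a linear factor; this turns `n |θ|³` into `|θ|` below. -/
theorem mul_exp_neg_two_mul_le {x : ℝ} : x * Real.exp (-(2 * x)) ≤ Real.exp (-x) := by
  have h1 : x ≤ Real.exp x := by linarith [Real.add_one_le_exp x]
  calc x * Real.exp (-(2 * x)) ≤ Real.exp x * Real.exp (-(2 * x)) := by gcongr
    _ = Real.exp (-x) := by rw [← Real.exp_add]; congr 1; ring

/-- Powers of a function with a quadratic expansion along the imaginary axis. -/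
theorem eventually_norm_pow_sub_exp_pow_le {u : ℂ → ℂ} (hu : AnalyticAt ℂ u 0) (hu0 : u 0 = 1)
    {b γ : ℝ} (h1 : deriv u 0 = b) (h2 : iteratedDeriv 2 u 0 - deriv u 0 ^ 2 = γ) (hγ : 0 < γ) :
    ∃ K : ℝ, 0 ≤ K ∧ ∀ᶠ θ : ℝ in 𝓝 0, ∀ n : ℕ, 1 ≤ n →
      ‖u (θ * Complex.I) ^ n‖ ≤ Real.exp (-(γ / 8 * n * θ ^ 2)) ∧
      ‖u (θ * Complex.I) ^ n
        - Complex.exp (b * (θ * Complex.I) + γ / 2 * (θ * Complex.I) ^ 2) ^ n‖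
        ≤ K * (|θ| * Real.exp (-(γ / 8 * n * θ ^ 2))) := by
  obtain ⟨C, hC, hev⟩ := exists_norm_sub_exp_le hu hu0 h1 h2
  have hlim : Tendsto (fun θ : ℝ => (θ : ℂ) * Complex.I) (𝓝 0) (𝓝 0) := by
    have : Continuous fun θ : ℝ => (θ : ℂ) * Complex.I := by fun_prop
    simpa using this.tendsto 0
  have e1 := hlim.eventually hev
  -- With `s = γ θ² / 4`, this makes the cubic error at most `s e^{-2s}`; since `‖E‖ = e^{-2s}` and
  -- `1 + s ≤ e^s`, it follows that `‖u‖ ≤ e^{-s}`.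
  have e2 : ∀ᶠ θ : ℝ in 𝓝 0, C * |θ| < Real.exp (-(γ / 2)) * (γ / 4) := by
    have : Continuous fun θ : ℝ => C * |θ| := by fun_prop
    refine (this.tendsto 0).eventually_lt_const ?_
    simp only [abs_zero, mul_zero]
    positivity
  have e3 : ∀ᶠ θ : ℝ in 𝓝 0, |θ| < 1 := by
    have : Continuous fun θ : ℝ => |θ| := by fun_prop
    exact (this.tendsto 0).eventually_lt_const (by simp)
  refine ⟨C * Real.exp (γ / 4) * (8 / γ), by positivity, ?_⟩
  filter_upwards [e1, e2, e3] with θ g1 g2 g3 n hn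
  set E := Complex.exp (b * (θ * Complex.I) + γ / 2 * (θ * Complex.I) ^ 2) with hE
  have hEn : ‖E‖ = Real.exp (-(γ * θ ^ 2 / 2)) := norm_exp_quadratic b γ θ
  have hd : ‖u (θ * Complex.I) - E‖ ≤ C * |θ| ^ 3 := by simpa using g1
  have hθ2 : θ ^ 2 ≤ 1 := by
    rw [← sq_abs]; exact pow_le_one₀ (abs_nonneg _) g3.le
  set s := γ * θ ^ 2 / 4 with hs
  have hs0 : 0 ≤ s := by positivity
  have hEm : ‖E‖ ≤ Real.exp (-s) := by
    rw [hEn]; apply Real.exp_le_exp.2; rw [hs]; nlinarith [sq_nonneg θ]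
  have hum : ‖u (θ * Complex.I)‖ ≤ Real.exp (-s) := by
    have h3 : ‖u (θ * Complex.I)‖ ≤ ‖E‖ + C * |θ| ^ 3 := by
      calc ‖u (θ * Complex.I)‖ = ‖E + (u (θ * Complex.I) - E)‖ := by congr 1; ring
        _ ≤ _ := (norm_add_le _ _).trans (by gcongr)
    have h4 : C * |θ| ^ 3 ≤ Real.exp (-(γ / 2)) * s := by
      calc C * |θ| ^ 3 = (C * |θ|) * |θ| ^ 2 := by ring
        _ ≤ Real.exp (-(γ / 2)) * (γ / 4) * |θ| ^ 2 := by gcongr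
        _ = Real.exp (-(γ / 2)) * s := by rw [sq_abs, hs]; ring
    have h5 : Real.exp (-(γ / 2)) ≤ Real.exp (-(2 * s)) := by
      apply Real.exp_le_exp.2; rw [hs]; nlinarith
    have h6 : ‖E‖ = Real.exp (-(2 * s)) := by rw [hEn, hs]; congr 1; ring
    have h7 : Real.exp (-s) = Real.exp (-(2 * s)) * Real.exp s := by
      rw [← Real.exp_add]; congr 1; ring
    have h8 := Real.add_one_le_exp s
    have h9 : Real.exp (-(γ / 2)) * s ≤ Real.exp (-(2 * s)) * s := by gcongr
    have h10 : Real.exp (-(2 * s)) * (s + 1) ≤ Real.exp (-(2 * s)) * Real.exp s := by gcongr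
    rw [h6] at h3
    rw [h7]
    linarith
  have hpow : ∀ k : ℕ, Real.exp (-s) ^ k = Real.exp (-(k * s)) := by
    intro k; rw [← Real.exp_nat_mul]; congr 1; ring
  constructor
  · rw [norm_pow]
    refine (pow_le_pow_left₀ (norm_nonneg _) hum n).trans ?_
    rw [hpow, Real.exp_le_exp, hs]
    have : 0 ≤ (n : ℝ) * (γ * θ ^ 2) := by positivity
    nlinarith
  · refine (norm_pow_sub_pow_le_mul hum hEm n).trans ?_
    rw [hpow]
    -- Passing from `n - 1` to `n` costs `e^s`, at most `e^{γ/4}`.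
    have h3 : Real.exp (-(((n - 1 : ℕ) : ℝ) * s))
        ≤ Real.exp (γ / 4) * Real.exp (-(2 * (γ / 8 * n * θ ^ 2))) := by
      rw [← Real.exp_add, Real.exp_le_exp, Nat.cast_sub hn, hs]
      push_cast
      nlinarith
    have h4 := mul_exp_neg_two_mul_le (x := γ / 8 * n * θ ^ 2)
    calc n * Real.exp (-(((n - 1 : ℕ) : ℝ) * s)) * ‖u (θ * Complex.I) - E‖
        ≤ n * (Real.exp (γ / 4) * Real.exp (-(2 * (γ / 8 * n * θ ^ 2)))) * (C * |θ| ^ 3) := by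
          gcongr
      _ = C * Real.exp (γ / 4) * (8 / γ) * (|θ| * ((γ / 8 * n * θ ^ 2)
          * Real.exp (-(2 * (γ / 8 * n * θ ^ 2))))) := by
          rw [← sq_abs θ]; field_simp
      _ ≤ _ := by gcongr

theorem LinRep.exists_norm_characteristic_sub_le {ι : Type*} [Fintype ι] [DecidableEq ι]
    [Nonempty ι] {R : LinRep ι} (hs : IsStochasticPair R.A R.B) (hap : R.AperiodicPair)
    {u : ℂ → ℂ} (hu : AnalyticAt ℂ u 0) (hu0 : u 0 = 1)
    (hdet : ∀ᶠ z in 𝓝 (0 : ℂ), (u z • (1 : Matrix ι ι ℂ) - tilt R.A R.B z).det = 0)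
    {b γ : ℝ} (h1 : deriv u 0 = b) (h2 : iteratedDeriv 2 u 0 - deriv u 0 ^ 2 = γ) (hγ : 0 < γ)
    (hξ0 : R.ξ ≠ 0) (hη0 : R.η ≠ 0) :
    ∃ c C a ρ : ℝ, 0 < c ∧ 0 ≤ C ∧ 0 < a ∧ 0 ≤ ρ ∧ ρ < 1 ∧ ∀ n : ℕ, 1 ≤ n → ∀ θ : ℝ, |θ| ≤ Real.pi →
      ‖(fun i => (R.ξ i : ℂ)) ⬝ᵥ (tilt R.A R.B (θ * Complex.I) ^ n *ᵥ fun i => (R.η i : ℂ))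
        - c * Complex.exp (b * (θ * Complex.I) + γ / 2 * (θ * Complex.I) ^ 2) ^ n‖
        ≤ C * (|θ| * Real.exp (-(a * n * θ ^ 2)) + ρ ^ n) := by
  obtain ⟨r, c, C₁, ρ₁, hc, hr0, hra, hC₁, hρ₁0, hρ₁1, hev⟩ :=
    hs.exists_quasi_power hu hu0 hdet R.ξ_nonneg hξ0 R.η_nonneg hη0
  obtain ⟨K, hK, hevK⟩ := eventually_norm_pow_sub_exp_pow_le hu hu0 h1 h2 hγ
  obtain ⟨K', hK', hevr⟩ := (hra.differentiableAt.isBigO_sub).exists_pos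
  have hlim : Tendsto (fun θ : ℝ => (θ : ℂ) * Complex.I) (𝓝 0) (𝓝 0) := by
    have : Continuous fun θ : ℝ => (θ : ℂ) * Complex.I := by fun_prop
    simpa using this.tendsto 0
  obtain ⟨δ, hδ, hloc⟩ := Metric.eventually_nhds_iff.1
    ((hlim.eventually hev).and (hevK.and (hlim.eventually hevr.bound)))
  -- On this compact set aperiodicity makes both the powers of the matrix and the Gaussian
  -- exponentially small; no comparison is needed there.
  set S : Set ℝ := {θ | δ ≤ |θ| ∧ |θ| ≤ Real.pi} with hS
  have hScomp : IsCompact S := by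
    refine (isCompact_Icc (a := -Real.pi) (b := Real.pi)).of_isClosed_subset ?_ ?_
    · exact (isClosed_le continuous_const continuous_abs).inter
        (isClosed_le continuous_abs continuous_const)
    · exact fun θ hθ => abs_le.1 hθ.2
  have hcont : Continuous fun θ : ℝ => tilt R.A R.B (θ * Complex.I) := by
    unfold tilt; fun_prop
  obtain ⟨C₂, ρ₂, hC₂, hρ₂0, hρ₂1, hfar⟩ := hScomp.exists_norm_pow_le hcont fun θ hθ μ hμ =>
    norm_lt_one_of_mem_spectrum_tilt hs hap (abs_pos.1 (hδ.trans_le hθ.1)) hθ.2 hμ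
  set ξ' : ι → ℂ := fun i => (R.ξ i : ℂ) with hξ'
  set η' : ι → ℂ := fun i => (R.η i : ℂ) with hη'
  set D := (∑ i, ‖ξ' i‖) * ‖η'‖ with hD
  have hD0 : 0 ≤ D := by positivity
  set ρ₃ := Real.exp (-(γ * δ ^ 2 / 2)) with hρ₃
  have hρ₃0 : 0 ≤ ρ₃ := (Real.exp_pos _).le
  have hρ₃1 : ρ₃ < 1 := by
    rw [hρ₃, Real.exp_lt_one_iff]
    have : 0 < γ * δ ^ 2 / 2 := by positivity
    linarith
  set ρ := max ρ₁ (max ρ₂ ρ₃) with hρ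
  have hρ0 : 0 ≤ ρ := le_max_of_le_left hρ₁0
  refine ⟨c, max (K' + c * K + C₁) (D * C₂ + c), γ / 8, ρ, hc,
    le_max_of_le_left (by positivity), by positivity, hρ0,
    max_lt hρ₁1 (max_lt hρ₂1 hρ₃1), fun n hn θ hθ => ?_⟩
  set E := Complex.exp (b * (θ * Complex.I) + γ / 2 * (θ * Complex.I) ^ 2) with hE
  set g := Real.exp (-(γ / 8 * n * θ ^ 2)) with hg
  have hg0 : 0 ≤ g := (Real.exp_pos _).le
  rcases lt_or_ge |θ| δ with hlt | hge
  · obtain ⟨l1, l2, l3⟩ := hloc (y := θ) (by simpa using hlt)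
    obtain ⟨l2a, l2b⟩ := l2 n hn
    have l1' := l1 n hn
    have l3' : ‖r (θ * Complex.I) - c‖ ≤ K' * |θ| := by simpa [hr0] using l3
    set U := u (θ * Complex.I) with hU
    set V := ξ' ⬝ᵥ (tilt R.A R.B (θ * Complex.I) ^ n *ᵥ η') with hV
    have hsplit : V - c * E ^ n = (V - r (θ * Complex.I) * U ^ n)
        + (r (θ * Complex.I) - c) * U ^ n + c * (U ^ n - E ^ n) := by ring
    have hρn : ρ₁ ^ n ≤ ρ ^ n := pow_le_pow_left₀ hρ₁0 (le_max_left _ _) n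
    calc ‖V - c * E ^ n‖ ≤ C₁ * ρ ^ n + K' * |θ| * g + c * (K * (|θ| * g)) := by
          rw [hsplit]
          refine (norm_add₃_le).trans ?_
          rw [norm_mul, norm_mul, Complex.norm_real, Real.norm_of_nonneg hc.le]
          gcongr
          exact l1'.trans (by gcongr)
      _ = (K' + c * K) * (|θ| * g) + C₁ * ρ ^ n := by ring
      _ ≤ (K' + c * K + C₁) * (|θ| * g) + (K' + c * K + C₁) * ρ ^ n := by
          have : 0 ≤ c * K := by positivity
          have h4 : K' + c * K ≤ K' + c * K + C₁ := by linarith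
          have h5 : C₁ ≤ K' + c * K + C₁ := by linarith [hK'.le]
          gcongr
      _ = (K' + c * K + C₁) * (|θ| * g + ρ ^ n) := by ring
      _ ≤ _ := by gcongr; exact le_max_left _ _
  · have l1 := hfar θ ⟨hge, hθ⟩ n
    have l2 := Matrix.norm_dotProduct_mulVec_le ξ' η' (tilt R.A R.B (θ * Complex.I) ^ n)
    have l3 : ‖E ^ n‖ ≤ ρ ^ n := by
      rw [norm_pow, norm_exp_quadratic]
      refine pow_le_pow_left₀ (Real.exp_pos _).le ?_ n
      refine le_trans ?_ ((le_max_right ρ₂ ρ₃).trans (le_max_right ρ₁ _))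
      rw [hρ₃, Real.exp_le_exp]
      have : δ ^ 2 ≤ θ ^ 2 := by rw [← sq_abs θ]; gcongr
      nlinarith
    have hρn : ρ₂ ^ n ≤ ρ ^ n :=
      pow_le_pow_left₀ hρ₂0 ((le_max_left ρ₂ ρ₃).trans (le_max_right ρ₁ _)) n
    calc _ ≤ D * (C₂ * ρ ^ n) + c * ρ ^ n := by
          refine (norm_sub_le _ _).trans ?_
          rw [norm_mul, Complex.norm_real, Real.norm_of_nonneg hc.le]
          gcongr
          refine l2.trans ?_
          gcongr
          exact l1.trans (by gcongr)
      _ = (D * C₂ + c) * (0 + ρ ^ n) := by ring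
      _ ≤ _ := by
          gcongr
          · exact le_max_right _ _
          · positivity

/-! ### Perron–Frobenius for primitive matrices -/

theorem Matrix.mem_spectrum_of_mulVec_eq_smul {ι : Type*} [Fintype ι] [DecidableEq ι]
    {S : Matrix ι ι ℂ} {μ : ℂ} {x : ι → ℂ} (hx : x ≠ 0) (h : S *ᵥ x = μ • x) :
    μ ∈ spectrum ℂ S := by
  rw [spectrum.mem_iff, Matrix.isUnit_iff_isUnit_det, isUnit_iff_ne_zero, not_not,
    ← Matrix.exists_mulVec_eq_zero_iff]
  refine ⟨x, hx, ?_⟩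
  rw [Matrix.sub_mulVec, sub_eq_zero, Matrix.algebraMap_eq_diagonal, h]
  ext i
  simp [Matrix.mulVec_diagonal]

theorem Matrix.mulVec_mono_of_nonneg {ι : Type*} [Fintype ι] {M : Matrix ι ι ℝ}
    (hM : ∀ i j, 0 ≤ M i j) {x y : ι → ℝ} (h : x ≤ y) : M *ᵥ x ≤ M *ᵥ y :=
  fun i => Finset.sum_le_sum fun j _ => mul_le_mul_of_nonneg_left (h j) (hM i j)

theorem Matrix.mulVec_pos_of_pos {ι : Type*} [Fintype ι] {M : Matrix ι ι ℝ}
    (hM : ∀ i j, 0 < M i j) {x : ι → ℝ} (hx : 0 ≤ x) (hx0 : x ≠ 0) (i : ι) : 0 < (M *ᵥ x) i := by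
  obtain ⟨j, hj⟩ : ∃ j, x j ≠ 0 := by
    by_contra! hc; exact hx0 (funext hc)
  exact Finset.sum_pos' (fun k _ => mul_nonneg (hM i k).le (hx k))
    ⟨j, Finset.mem_univ j, mul_pos (hM i j) ((hx j).lt_of_ne' hj)⟩

/-- A strict inequality leaves room for some `s > r` with `s y ≤ M y`. Then the powers of `M / s`
keep `y` from shrinking, although its spectrum lies inside the open unit disc. -/
theorem Matrix.not_forall_lt_mulVec {ι : Type*} [Fintype ι] [DecidableEq ι] [Nonempty ι]
    {M : Matrix ι ι ℝ} (hM : ∀ i j, 0 ≤ M i j) {r : ℝ} (hr : 0 ≤ r)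
    (hspec : ∀ μ ∈ spectrum ℂ (M.map ((↑) : ℝ → ℂ)), ‖μ‖ ≤ r) {y : ι → ℝ} (hy : ∀ i, 0 < y i) :
    ¬ ∀ i, r * y i < (M *ᵥ y) i := by
  intro hlt
  obtain ⟨s, hs⟩ : ∃ s, r < s ∧ ∀ i, s * y i ≤ (M *ᵥ y) i := by
    have hev : ∀ᶠ s in 𝓝[>] r, ∀ i, s * y i < (M *ᵥ y) i := by
      refine eventually_all.2 fun i => ?_
      have : Continuous fun s : ℝ => s * y i := by fun_prop
      exact ((this.tendsto r).eventually_lt_const (hlt i)).filter_mono nhdsWithin_le_nhds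
    obtain ⟨s, h1, h2⟩ := (hev.and self_mem_nhdsWithin).exists
    exact ⟨s, h2, fun i => (h1 i).le⟩
  obtain ⟨hrs, hs⟩ := hs
  have hs0 : 0 < s := hr.trans_lt hrs
  set N : Matrix ι ι ℝ := s⁻¹ • M with hN
  have hN0 : ∀ i j, 0 ≤ N i j := fun i j => mul_nonneg (inv_pos.2 hs0).le (hM i j)
  have hNy : y ≤ N *ᵥ y := by
    intro i
    rw [hN, Matrix.smul_mulVec, Pi.smul_apply, smul_eq_mul, le_inv_mul_iff₀ hs0]
    exact hs i
  have hNn : ∀ n : ℕ, y ≤ N ^ n *ᵥ y := by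
    intro n
    induction n with
    | zero => simp
    | succ n ih =>
      rw [pow_succ', ← Matrix.mulVec_mulVec]
      exact hNy.trans (Matrix.mulVec_mono_of_nonneg hN0 ih)
  have hspecN : ∀ μ ∈ spectrum ℂ (N.map ((↑) : ℝ → ℂ)), ‖μ‖ < 1 := by
    intro μ hμ
    obtain ⟨x, hx, he⟩ := Matrix.exists_mulVec_eq_smul_of_mem_spectrum hμ
    have hsc : (s : ℂ) ≠ 0 := by exact_mod_cast hs0.ne'
    have hMN : M.map ((↑) : ℝ → ℂ) = (s : ℂ) • N.map ((↑) : ℝ → ℂ) := by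
      ext i j
      simp [hN, hsc]
    have := hspec _ (Matrix.mem_spectrum_of_mulVec_eq_smul (μ := s * μ) hx (by
      rw [hMN, Matrix.smul_mulVec, he, smul_smul]))
    rw [norm_mul, Complex.norm_real, Real.norm_of_nonneg hs0.le] at this
    by_contra! hc
    nlinarith
  obtain ⟨C, ρ, hC, hρ0, hρ1, hbd⟩ := eventually_forall_norm_pow_le
    (S := fun _ : ℝ => N.map ((↑) : ℝ → ℂ)) (x₀ := 0) continuousAt_const hspecN
  have hbd' := hbd.self_of_nhds
  obtain ⟨i⟩ := ‹Nonempty ι›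
  set yc : ι → ℂ := fun i => (y i : ℂ) with hyc
  have hle : ∀ n : ℕ, y i ≤ C * ‖yc‖ * ρ ^ n := by
    intro n
    have h1 : (N.map ((↑) : ℝ → ℂ) ^ n *ᵥ yc) i = ((N ^ n *ᵥ y) i : ℝ) := by
      have : N.map ((↑) : ℝ → ℂ) ^ n = (N ^ n).map ((↑) : ℝ → ℂ) :=
        (Matrix.map_pow N Complex.ofRealHom n).symm
      rw [this]
      simp [Matrix.mulVec, dotProduct, hyc]
    calc y i ≤ (N ^ n *ᵥ y) i := hNn n i
      _ ≤ ‖(N.map ((↑) : ℝ → ℂ) ^ n *ᵥ yc) i‖ := by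
          rw [h1, Complex.norm_real]; exact Real.le_norm_self _
      _ ≤ ‖N.map ((↑) : ℝ → ℂ) ^ n *ᵥ yc‖ := norm_le_pi_norm _ i
      _ ≤ ‖N.map ((↑) : ℝ → ℂ) ^ n‖ * ‖yc‖ := Matrix.linfty_opNorm_mulVec _ _
      _ ≤ C * ρ ^ n * ‖yc‖ := by gcongr; exact hbd' n
      _ = _ := by ring
  have hlim : Tendsto (fun n : ℕ => C * ‖yc‖ * ρ ^ n) atTop (𝓝 0) := by
    simpa using (tendsto_pow_atTop_nhds_zero_of_lt_one hρ0 hρ1).const_mul (C * ‖yc‖)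
  exact absurd (ge_of_tendsto' hlim hle) (not_le.2 (hy i))

/-- The Perron–Frobenius theorem for primitive matrices: the spectral radius is positive and has
a positive eigenvector. -/
theorem Matrix.IsPrimitive.exists_pos_eigenvector {ι : Type*} [Fintype ι] [DecidableEq ι]
    [Nonempty ι] {M : Matrix ι ι ℝ} (hM : M.IsPrimitive) :
    0 < (spectralRadius ℂ (M.map ((↑) : ℝ → ℂ))).toReal ∧ ∃ v : ι → ℝ, (∀ i, 0 < v i) ∧
      M *ᵥ v = (spectralRadius ℂ (M.map ((↑) : ℝ → ℂ))).toReal • v := by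
  obtain ⟨μ, hμ, hμr⟩ := spectrum.exists_nnnorm_eq_spectralRadius (M.map ((↑) : ℝ → ℂ))
  set r := (spectralRadius ℂ (M.map ((↑) : ℝ → ℂ))).toReal with hr
  have hr_eq : r = ‖μ‖ := by rw [hr, ← hμr]; simp
  have hspec : ∀ ν ∈ spectrum ℂ (M.map ((↑) : ℝ → ℂ)), ‖ν‖ ≤ r := by
    intro ν hν
    have h1 : (‖ν‖₊ : ENNReal) ≤ ‖μ‖₊ := by
      rw [hμr]
      exact le_iSup₂ (f := fun k (_ : k ∈ spectrum ℂ (M.map ((↑) : ℝ → ℂ))) =>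
        (‖k‖₊ : ENNReal)) ν hν
    rw [hr_eq]
    exact_mod_cast h1
  have hr0 : 0 ≤ r := hr_eq ▸ norm_nonneg μ
  obtain ⟨x, hx, he⟩ := Matrix.exists_mulVec_eq_smul_of_mem_spectrum hμ
  set y : ι → ℝ := fun i => ‖x i‖ with hy
  have hy0 : 0 ≤ y := fun i => norm_nonneg _
  have hyne : y ≠ 0 := by
    intro h
    exact hx (funext fun i => norm_eq_zero.1 (congrFun h i))
  have hle : r • y ≤ M *ᵥ y := by
    intro i
    have h1 := congrFun he i
    have h2 : (r • y) i = ‖(M.map ((↑) : ℝ → ℂ) *ᵥ x) i‖ := by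
      rw [h1]; simp [hy, hr_eq]
    rw [h2]
    refine (norm_sum_le _ _).trans (Finset.sum_le_sum fun j _ => ?_)
    simp [hy, abs_of_nonneg (hM.nonneg i j)]
  obtain ⟨k, hk, hpos⟩ := hM.exists_pos_pow
  -- Otherwise the nonzero defect becomes positive everywhere under `M ^ k`, so `M ^ k y` violates
  -- `not_forall_lt_mulVec`.
  have heq : M *ᵥ y = r • y := by
    by_contra hne
    have hd : 0 ≤ M *ᵥ y - r • y := sub_nonneg.2 hle
    have hdne : M *ᵥ y - r • y ≠ 0 := sub_ne_zero.2 hne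
    refine Matrix.not_forall_lt_mulVec hM.nonneg hr0 hspec
      (Matrix.mulVec_pos_of_pos hpos hy0 hyne) fun i => ?_
    have h1 := Matrix.mulVec_pos_of_pos hpos hd hdne i
    rw [Matrix.mulVec_sub, Matrix.mulVec_smul, Matrix.mulVec_mulVec, ← pow_succ, pow_succ',
      ← Matrix.mulVec_mulVec] at h1
    simpa using h1
  have hpow : ∀ n : ℕ, M ^ n *ᵥ y = r ^ n • y := by
    intro n
    induction n with
    | zero => simp
    | succ n ih =>
      rw [pow_succ, ← Matrix.mulVec_mulVec, heq, Matrix.mulVec_smul, ih, smul_smul, ← pow_succ']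
  have hprod : ∀ i, 0 < r ^ k * y i := by
    intro i
    have := Matrix.mulVec_pos_of_pos hpos hy0 hyne i
    rw [hpow k] at this
    simpa using this
  refine ⟨?_, y, fun i => ?_, heq⟩
  · obtain ⟨i⟩ := ‹Nonempty ι›
    refine hr0.lt_of_ne' fun h => ?_
    have := hprod i
    rw [h, zero_pow hk.ne', zero_mul] at this
    exact lt_irrefl _ this
  · exact (hy0 i).lt_of_ne' fun h => by
      have := hprod i
      rw [h, Pi.zero_apply, mul_zero] at this
      exact lt_irrefl _ this

/-! ### Reduction to the stochastic case -/

namespace LinRep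

variable {ι : Type*}

/-- Rescaling of a linear representation by a positive vector `v` and a positive scalar `r`. -/
noncomputable def rescale (R : LinRep ι) {v : ι → ℝ} (hv : ∀ i, 0 < v i) {r : ℝ} (hr : 0 < r) :
    LinRep ι where
  ξ i := R.ξ i * v i
  A := Matrix.of fun i j => R.A i j * v j / (r * v i)
  B := Matrix.of fun i j => R.B i j * v j / (r * v i)
  η i := R.η i / v i
  ξ_nonneg i := mul_nonneg (R.ξ_nonneg i) (hv i).le
  A_nonneg i j := div_nonneg (mul_nonneg (R.A_nonneg i j) (hv j).le) (mul_pos hr (hv i)).le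
  B_nonneg i j := div_nonneg (mul_nonneg (R.B_nonneg i j) (hv j).le) (mul_pos hr (hv i)).le
  η_nonneg i := div_nonneg (R.η_nonneg i) (hv i).le

section
variable {R : LinRep ι} {v : ι → ℝ} (hv : ∀ i, 0 < v i) {r : ℝ} (hr : 0 < r)

theorem IsWalk.rescale {i j : ι} {w : List Bool} (hw : R.IsWalk i w j) :
    (R.rescale hv hr).IsWalk i w j := by
  induction hw with
  | nil i => exact .nil i
  | @cons i j k x w hx _ ih =>
    refine .cons ?_ ih
    have := hv i
    have := hv j
    cases x <;> simp only [letterMatrix, LinRep.rescale] at hx ⊢ <;> simp at hx ⊢ <;> positivity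

theorem AperiodicPair.rescale (h : R.AperiodicPair) : (R.rescale hv hr).AperiodicPair := by
  intro d hd
  refine h d ?_
  rintro x ⟨w₁, w₂, ⟨h1, i, hi⟩, ⟨h2, j, hj⟩, hlen, rfl⟩
  exact hd _ ⟨w₁, w₂, ⟨h1, i, hi.rescale hv hr⟩, ⟨h2, j, hj.rescale hv hr⟩, hlen, rfl⟩

theorem tilt_rescale (z : ℂ) (i j : ι) :
    tilt (R.rescale hv hr).A (R.rescale hv hr).B z i j
      = tilt R.A R.B z i j * v j / (r * v i) := by
  simp only [tilt_apply, LinRep.rescale, Matrix.of_apply]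
  push_cast
  ring

variable [Fintype ι] [DecidableEq ι]

theorem rescale_M_pow (n : ℕ) (i j : ι) :
    (((R.rescale hv hr).A + (R.rescale hv hr).B) ^ n) i j
      = (R.M ^ n) i j * v j / (r ^ n * v i) := by
  induction n generalizing j with
  | zero =>
    rcases eq_or_ne i j with rfl | h
    · simp [(hv i).ne']
    · simp [Matrix.one_apply_ne h]
  | succ n ih =>
    rw [pow_succ, Matrix.mul_apply, pow_succ, Matrix.mul_apply, Finset.sum_mul, Finset.sum_div]
    refine Finset.sum_congr rfl fun k _ => ?_
    rw [ih]
    simp only [LinRep.rescale, Matrix.add_apply, Matrix.of_apply, M]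
    have := (hv i).ne'
    have := (hv k).ne'
    field_simp
    ring

theorem isStochasticPair_rescale (hprim : R.M.IsPrimitive) (hev : R.M *ᵥ v = r • v) :
    IsStochasticPair (R.rescale hv hr).A (R.rescale hv hr).B where
  A_nonneg := (R.rescale hv hr).A_nonneg
  B_nonneg := (R.rescale hv hr).B_nonneg
  sum_row i := by
    have h1 := fun j => rescale_M_pow (R := R) hv hr 1 i j
    simp only [pow_one] at h1
    simp only [h1, ← Finset.sum_div]
    have h2 := congrFun hev i
    simp only [Matrix.mulVec, dotProduct, Pi.smul_apply, smul_eq_mul] at h2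
    rw [h2]
    exact div_self (mul_pos hr (hv i)).ne'
  primitive := by
    obtain ⟨k, hk, hpos⟩ := hprim.exists_pos_pow
    refine ⟨fun i j => add_nonneg ((R.rescale hv hr).A_nonneg i j)
      ((R.rescale hv hr).B_nonneg i j), k, hk, fun i j => ?_⟩
    rw [rescale_M_pow]
    have := hpos i j
    have := hv i
    have := hv j
    positivity

/-- Rescaling is conjugation by the diagonal matrix of `v` followed by division by `r`, so
eigenvalue branches are only divided by `r`. -/
theorem det_rescale (z s : ℂ) :
    (r : ℂ) ^ Fintype.card ι * (s • (1 : Matrix ι ι ℂ)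
      - tilt (R.rescale hv hr).A (R.rescale hv hr).B z).det
      = ((r * s) • (1 : Matrix ι ι ℂ) - tilt R.A R.B z).det := by
  have hvc : ∀ i, (v i : ℂ) ≠ 0 := fun i => by exact_mod_cast (hv i).ne'
  have hrc : (r : ℂ) ≠ 0 := by exact_mod_cast hr.ne'
  rw [← Matrix.det_smul]
  have : (r : ℂ) • (s • (1 : Matrix ι ι ℂ) - tilt (R.rescale hv hr).A (R.rescale hv hr).B z)
      = Matrix.diagonal (fun i => (v i : ℂ)⁻¹) * ((r * s) • (1 : Matrix ι ι ℂ) - tilt R.A R.B z)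
        * Matrix.diagonal (fun i => (v i : ℂ)) := by
    ext i j
    rw [Matrix.mul_diagonal, Matrix.diagonal_mul]
    simp only [Matrix.smul_apply, Matrix.sub_apply, tilt_rescale, smul_eq_mul]
    have := hvc i
    rcases eq_or_ne i j with rfl | h
    · simp; field_simp
    · simp [Matrix.one_apply_ne h]; field_simp
  rw [this, Matrix.det_mul, Matrix.det_mul, Matrix.det_diagonal, Matrix.det_diagonal,
    mul_comm, ← mul_assoc, ← Finset.prod_mul_distrib]
  simp [hvc]

theorem rescale_tilt_pow_mulVec (z : ℂ) (n : ℕ) (i : ι) :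
    (tilt (R.rescale hv hr).A (R.rescale hv hr).B z ^ n *ᵥ
      fun i => ((R.rescale hv hr).η i : ℂ)) i
      = (tilt R.A R.B z ^ n *ᵥ fun i => (R.η i : ℂ)) i / (r ^ n * v i) := by
  have hvc : ∀ i, (v i : ℂ) ≠ 0 := fun i => by exact_mod_cast (hv i).ne'
  have hrc : (r : ℂ) ≠ 0 := by exact_mod_cast hr.ne'
  induction n generalizing i with
  | zero => simp [LinRep.rescale]
  | succ n ih =>
    rw [pow_succ', ← Matrix.mulVec_mulVec, pow_succ' (tilt R.A R.B z), ← Matrix.mulVec_mulVec]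
    rw [Matrix.mulVec, dotProduct, Matrix.mulVec, dotProduct, Finset.sum_div]
    refine Finset.sum_congr rfl fun j _ => ?_
    rw [ih, tilt_rescale]
    have := hvc i
    have := hvc j
    field_simp
    ring

theorem rescale_dotProduct_tilt_pow (z : ℂ) (n : ℕ) :
    (fun i => ((R.rescale hv hr).ξ i : ℂ)) ⬝ᵥ
      (tilt (R.rescale hv hr).A (R.rescale hv hr).B z ^ n *ᵥ
        fun i => ((R.rescale hv hr).η i : ℂ))
      = (fun i => (R.ξ i : ℂ)) ⬝ᵥ (tilt R.A R.B z ^ n *ᵥ fun i => (R.η i : ℂ)) / r ^ n := by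
  have hvc : ∀ i, (v i : ℂ) ≠ 0 := fun i => by exact_mod_cast (hv i).ne'
  simp only [dotProduct]
  rw [Finset.sum_div]
  refine Finset.sum_congr rfl fun i _ => ?_
  rw [rescale_tilt_pow_mulVec]
  simp only [LinRep.rescale]
  have := hvc i
  push_cast
  field_simp

end

variable [Fintype ι] [DecidableEq ι]

theorem component_estimate {R : LinRep ι} (hprim : R.M.IsPrimitive) (hap : R.AperiodicPair)
    (hξ : R.ξ ≠ 0) (hη : R.η ≠ 0) :
    0 < R.perronEigenvalue ∧ 0 < R.gamma ∧
    ∃ c C a ρ : ℝ, 0 < c ∧ 0 ≤ C ∧ 0 < a ∧ 0 ≤ ρ ∧ ρ < 1 ∧ ∀ n : ℕ, 1 ≤ n → ∀ θ : ℝ,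
      |θ| ≤ Real.pi →
      ‖(fun i => (R.ξ i : ℂ)) ⬝ᵥ (tilt R.A R.B (θ * Complex.I) ^ n *ᵥ fun i => (R.η i : ℂ))
          / (R.perronEigenvalue : ℂ) ^ n
        - c * Complex.exp (R.beta * (θ * Complex.I) + R.gamma / 2 * (θ * Complex.I) ^ 2) ^ n‖
        ≤ C * (|θ| * Real.exp (-(a * n * θ ^ 2)) + ρ ^ n) := by
  have hne : Nonempty ι := by
    by_contra hc
    rw [not_nonempty_iff] at hc
    exact hξ (Subsingleton.elim _ _)
  obtain ⟨hr, v, hv, hev⟩ := hprim.exists_pos_eigenvector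
  change 0 < R.perronEigenvalue at hr
  change R.M *ᵥ v = R.perronEigenvalue • v at hev
  set r := R.perronEigenvalue with hr_def
  have hrc : (r : ℂ) ≠ 0 := by exact_mod_cast hr.ne'
  have hS := isStochasticPair_rescale hv hr hprim hev
  have hap' := hap.rescale hv hr
  -- `R.u` is a choice, so only existence of a branch is required: the moment formulas hold for
  -- whichever branch is chosen.
  have hbranch : R.IsPerronBranch R.u := by
    obtain ⟨u₀, h1, h2, h3⟩ := hS.exists_branch
    refine Classical.epsilon_spec (p := R.IsPerronBranch)
      ⟨fun z => r * u₀ z, analyticAt_const.mul h1, by simp [h2, hr_def], ?_⟩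
    filter_upwards [h3] with z hz
    have := det_rescale (R := R) hv hr z (u₀ z)
    rw [hz, mul_zero] at this
    rw [sub_sub]
    exact this.symm
  set u : ℂ → ℂ := fun z => R.u z / r with hu_def
  have hu : AnalyticAt ℂ u 0 := hbranch.analyticAt.div analyticAt_const hrc
  have hu0 : u 0 = 1 := by
    simp only [hu_def, hbranch.map_zero]
    exact div_self hrc
  have hdet : ∀ᶠ z in 𝓝 (0 : ℂ), (u z • (1 : Matrix ι ι ℂ)
      - tilt (R.rescale hv hr).A (R.rescale hv hr).B z).det = 0 := by
    filter_upwards [hbranch.det_eq_zero] with z hz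
    have := det_rescale (R := R) hv hr z (u z)
    rw [show (r : ℂ) * u z = R.u z from mul_div_cancel₀ _ hrc] at this
    rw [sub_sub] at hz
    rw [show (R.u z • (1 : Matrix ι ι ℂ) - tilt R.A R.B z).det = 0 from hz] at this
    exact (mul_eq_zero.1 this).resolve_left (pow_ne_zero _ hrc)
  have hd1 : deriv u 0 = deriv R.u 0 / r := deriv_div_const _
  have hd2 : iteratedDeriv 2 u 0 = iteratedDeriv 2 R.u 0 / r := by
    rw [iteratedDeriv_succ, iteratedDeriv_one, iteratedDeriv_succ, iteratedDeriv_one]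
    have : deriv u = fun z => deriv R.u z / r := funext fun z => deriv_div_const _
    rw [this, deriv_div_const]
  obtain ⟨p, hp⟩ := hS.exists_isStationary
  obtain ⟨b, g, hb, hg⟩ := hS.exists_moments hp hu hu0 hdet
  have hgpos := hap'.sum_sq_pos hp.pos (g := g) b
  set γ := ∑ i, p i * ∑ j, ((R.rescale hv hr).A i j * (1 + (g j - g i - b)) ^ 2
    + (R.rescale hv hr).B i j * (g j - g i - b) ^ 2) with hγ
  have hbeta : R.beta = b := by
    rw [beta, ← hr_def, ← hd1, hb, Complex.ofReal_re]
  have hgamma : R.gamma = γ := by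
    rw [gamma, ← hr_def, ← hd1, ← hd2, hg, Complex.ofReal_re]
  have hξ' : (R.rescale hv hr).ξ ≠ 0 := fun h => hξ (funext fun i =>
    (mul_eq_zero.1 (congrFun h i)).resolve_right (hv i).ne')
  have hη' : (R.rescale hv hr).η ≠ 0 := fun h => hη (funext fun i =>
    (div_eq_zero_iff.1 (congrFun h i)).resolve_right (hv i).ne')
  obtain ⟨c, C, a, ρ, h1, h2, h3, h4, h5, h6⟩ :=
    exists_norm_characteristic_sub_le hS hap' hu hu0 hdet hb hg hgpos hξ' hη'
  refine ⟨hr, hgamma ▸ hgpos, c, C, a, ρ, h1, h2, h3, h4, h5, fun n hn θ hθ => ?_⟩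
  have := h6 n hn θ hθ
  rw [rescale_dotProduct_tilt_pow] at this
  rw [hbeta, hgamma]
  exact this

end LinRep

/-! ### Generating functions and Fourier inversion -/

namespace LinRep

variable {ι : Type*} [Fintype ι] [DecidableEq ι] (R : LinRep ι)

/-- Expanding the product letter by letter, each `a` contributes one factor `e^z`. -/
theorem tilt_pow_eq_sum (z : ℂ) (n : ℕ) :
    tilt R.A R.B z ^ n = ∑ w : Fin n → Bool,
      Complex.exp (((List.ofFn w).count true : ℕ) * z) •
        (R.mu (List.ofFn w)).map ((↑) : ℝ → ℂ) := by
  induction n with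
  | zero => simp [mu]
  | succ n ih =>
    rw [pow_succ', ih, ← (Fin.consEquiv fun _ => Bool).sum_comp, Fintype.sum_prod_type,
      Fintype.sum_bool, ← Finset.sum_add_distrib, Finset.mul_sum]
    refine Finset.sum_congr rfl fun w _ => ?_
    have hmul : ∀ S T : Matrix ι ι ℝ, (S * T).map ((↑) : ℝ → ℂ)
        = S.map ((↑) : ℝ → ℂ) * T.map ((↑) : ℝ → ℂ) := fun S T =>
      Matrix.map_mul (f := Complex.ofRealHom)
    simp only [Fin.consEquiv_apply, List.ofFn_succ, Fin.cons_zero, Fin.cons_succ, mu, List.map_cons,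
      List.prod_cons, List.count_cons_self, hmul]
    rw [List.count_cons_of_ne (by simp)]
    simp only [letterMatrix, if_true, Bool.false_eq_true, if_false, tilt]
    rw [mul_smul_comm, add_mul, smul_mul_assoc, smul_add, smul_smul, ← Complex.exp_add]
    congr 3
    push_cast
    ring

/-- The generating function of the symbol statistics of `R`. -/
noncomputable def genFun (n : ℕ) (z : ℂ) : ℂ :=
  (fun i => (R.ξ i : ℂ)) ⬝ᵥ (tilt R.A R.B z ^ n *ᵥ fun i => (R.η i : ℂ))

theorem genFun_eq_sum (n : ℕ) (z : ℂ) :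
    R.genFun n z = ∑ w : Fin n → Bool,
      (R.series (List.ofFn w) : ℂ) * Complex.exp (((List.ofFn w).count true : ℕ) * z) := by
  rw [genFun, tilt_pow_eq_sum, Matrix.sum_mulVec, dotProduct_sum]
  refine Finset.sum_congr rfl fun w _ => ?_
  rw [Matrix.smul_mulVec, dotProduct_smul, smul_eq_mul, mul_comm]
  congr 1
  simp [series, dotProduct, Matrix.mulVec]

theorem genFun_zero (n : ℕ) :
    R.genFun n 0 = ((∑ w : Fin n → Bool, R.series (List.ofFn w) : ℝ) : ℂ) := by
  rw [genFun_eq_sum]; simp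

theorem integral_exp_sub (j k : ℕ) :
    ∫ θ in (-Real.pi)..Real.pi, Complex.exp (j * (θ * Complex.I)) * Complex.exp (-(k * θ * Complex.I))
      = if j = k then (2 * Real.pi : ℂ) else 0 := by
  have h1 : ∀ θ : ℝ, Complex.exp (j * (θ * Complex.I)) * Complex.exp (-(k * θ * Complex.I))
      = Complex.exp ((((j : ℤ) - k : ℤ) * Complex.I) * θ) := by
    intro θ; rw [← Complex.exp_add]; congr 1; push_cast; ring
  simp only [h1]
  split_ifs with h
  · subst h
    simp
    ring
  · have hm : (((j : ℤ) - k : ℤ) : ℂ) ≠ 0 := by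
      rw [Int.cast_ne_zero, sub_ne_zero]; exact_mod_cast h
    rw [integral_exp_mul_complex (mul_ne_zero hm Complex.I_ne_zero)]
    have h2 : Complex.exp ((((j : ℤ) - k : ℤ) * Complex.I) * (Real.pi : ℝ))
        = Complex.exp ((((j : ℤ) - k : ℤ) * Complex.I) * ((-Real.pi : ℝ) : ℂ)) := by
      rw [Complex.exp_eq_exp_iff_exists_int]
      exact ⟨(j : ℤ) - k, by push_cast; ring⟩
    rw [h2, sub_self, zero_div]

theorem integral_genFun (n k : ℕ) (hZ : ∑ w : Fin n → Bool, R.series (List.ofFn w) ≠ 0) :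
    ∫ θ in (-Real.pi)..Real.pi,
        R.genFun n (θ * Complex.I) * Complex.exp (-(k * θ * Complex.I))
      = (2 * Real.pi * ((∑ w : Fin n → Bool, R.series (List.ofFn w)) * R.probY n k) : ℝ) := by
  have h2 : (∑ w : Fin n → Bool, R.series (List.ofFn w)) * R.probY n k
      = ∑ w : Fin n → Bool, if (List.ofFn w).count true = k then R.series (List.ofFn w) else 0 := by
    rw [probY, Finset.mul_sum, ← Finset.sum_filter]
    exact Finset.sum_congr rfl fun w _ => mul_div_cancel₀ _ hZ
  rw [h2, Finset.mul_sum, Complex.ofReal_sum]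
  simp only [genFun_eq_sum, Finset.sum_mul, mul_assoc]
  rw [intervalIntegral.integral_finsetSum]
  · simp only [intervalIntegral.integral_const_mul]
    have h1 := fun j => integral_exp_sub j k
    simp only [mul_assoc] at h1
    simp only [h1]
    refine Finset.sum_congr rfl fun w _ => ?_
    split_ifs
    · push_cast; ring
    · simp
  · intro w _
    apply Continuous.intervalIntegrable
    fun_prop

theorem genFun_directSum {ι₁ ι₂ : Type*} [Fintype ι₁] [DecidableEq ι₁] [Fintype ι₂]
    [DecidableEq ι₂] (R₁ : LinRep ι₁) (R₂ : LinRep ι₂) (n : ℕ) (z : ℂ) :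
    (R₁.directSum R₂).genFun n z = R₁.genFun n z + R₂.genFun n z := by
  have h1 : tilt (R₁.directSum R₂).A (R₁.directSum R₂).B z
      = Matrix.fromBlocks (tilt R₁.A R₁.B z) 0 0 (tilt R₂.A R₂.B z) := by
    ext (i | i) (j | j) <;> simp [tilt_apply, directSum]
  have h2 : ∀ m : ℕ, Matrix.fromBlocks (tilt R₁.A R₁.B z) 0 0 (tilt R₂.A R₂.B z) ^ m
      = Matrix.fromBlocks (tilt R₁.A R₁.B z ^ m) 0 0 (tilt R₂.A R₂.B z ^ m) := by
    intro m
    induction m with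
    | zero => simp
    | succ m ih => rw [pow_succ, ih, Matrix.fromBlocks_multiply]; simp [pow_succ]
  simp only [genFun, h1, h2, dotProduct, Matrix.mulVec, Fintype.sum_sum_type]
  simp [directSum]

end LinRep

/-! ### Gaussian integrals and the local limit theorem -/

open MeasureTheory in
theorem integrable_abs_mul_exp_neg_mul_sq {b : ℝ} (hb : 0 < b) :
    Integrable fun x : ℝ => |x| * Real.exp (-(b * x ^ 2)) := by
  have := (integrable_mul_exp_neg_mul_sq hb).norm
  simpa [abs_mul] using this

open MeasureTheory in
theorem integral_abs_mul_exp_neg_mul_sq {b : ℝ} (hb : 0 < b) :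
    ∫ x : ℝ, |x| * Real.exp (-(b * x ^ 2)) = b⁻¹ := by
  have h1 := integral_comp_abs (f := fun x : ℝ => x * Real.exp (-(b * x ^ 2)))
  simp only [sq_abs] at h1
  rw [h1]
  have h2 := integral_mul_cexp_neg_mul_sq (b := (b : ℂ)) (by simpa using hb)
  have h3 : ∫ r : ℝ in Set.Ioi 0, (r : ℂ) * Complex.exp (-b * (r : ℂ) ^ 2)
      = ((∫ r : ℝ in Set.Ioi 0, r * Real.exp (-(b * r ^ 2)) : ℝ) : ℂ) := by
    rw [← integral_complex_ofReal]
    congr 1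
    ext r
    push_cast
    congr 2
    ring
  rw [h3] at h2
  have h4 : ∫ r : ℝ in Set.Ioi 0, r * Real.exp (-(b * r ^ 2)) = (2 * b)⁻¹ := by
    exact_mod_cast h2
  rw [h4]
  field_simp

open MeasureTheory in
theorem integral_exp_quadratic_pow {b γ : ℝ} (hγ : 0 < γ) {n : ℕ} (hn : 1 ≤ n) (k : ℕ) :
    ∫ θ : ℝ, Complex.exp (b * (θ * Complex.I) + γ / 2 * (θ * Complex.I) ^ 2) ^ n
        * Complex.exp (-(k * θ * Complex.I))
      = ((2 * Real.pi * (Real.exp (-((k : ℝ) - b * n) ^ 2 / (2 * γ * n))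
        / Real.sqrt (2 * Real.pi * γ) / Real.sqrt n) : ℝ) : ℂ) := by
  have hn0 : (0 : ℝ) < n := by exact_mod_cast hn
  have hpos : 0 < n * γ / 2 := by positivity
  have h1 : ∀ θ : ℝ, Complex.exp (b * (θ * Complex.I) + γ / 2 * (θ * Complex.I) ^ 2) ^ n
        * Complex.exp (-(k * θ * Complex.I))
      = Complex.exp (Complex.I * ((b * n - k : ℝ) : ℂ) * θ)
        * Complex.exp (-((n * γ / 2 : ℝ) : ℂ) * (θ : ℂ) ^ 2) := by
    intro θ
    rw [← Complex.exp_nat_mul, ← Complex.exp_add, ← Complex.exp_add]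
    congr 1
    push_cast
    rw [mul_pow, Complex.I_sq]
    ring
  simp only [h1]
  rw [fourierIntegral_gaussian (by rw [Complex.ofReal_re]; exact hpos)]
  have h2 : ((Real.pi : ℂ) / ((n * γ / 2 : ℝ) : ℂ)) ^ (1 / 2 : ℂ)
      = ((2 * Real.pi / Real.sqrt (2 * Real.pi * γ) / Real.sqrt n : ℝ) : ℂ) := by
    have h3 : Real.sqrt (Real.pi / (n * γ / 2))
        = 2 * Real.pi / Real.sqrt (2 * Real.pi * γ) / Real.sqrt n := by
      rw [div_div, ← Real.sqrt_mul (by positivity)]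
      rw [Real.sqrt_eq_iff_mul_self_eq (by positivity) (by positivity), div_mul_div_comm,
        Real.mul_self_sqrt (by positivity)]
      field_simp
    rw [← h3, Real.sqrt_eq_rpow, Complex.ofReal_cpow (by positivity)]
    push_cast
    rfl
  have h4 : -(((b * n - k : ℝ) : ℂ)) ^ 2 / (4 * ((n * γ / 2 : ℝ) : ℂ))
      = ((-((k : ℝ) - b * n) ^ 2 / (2 * γ * n) : ℝ) : ℂ) := by
    have : (n : ℂ) ≠ 0 := by exact_mod_cast hn0.ne'
    have : (γ : ℂ) ≠ 0 := by exact_mod_cast hγ.ne'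
    push_cast
    field_simp
    ring
  rw [h2, h4, ← Complex.ofReal_exp, ← Complex.ofReal_mul]
  congr 1
  ring

-- The Gaussian is integrated over the whole line. Its tail lies where `1 ≤ |θ|`, so a factor `|θ|`
-- may be inserted there; the integral becomes `b⁻¹`, which is of order `1 / n` in the application,
-- like the main error.
open MeasureTheory in
theorem norm_integral_sub_le {φ E : ℝ → ℂ} (hφ : Continuous φ) (hE : Continuous E)
    {c C a b q : ℝ} (hc : 0 ≤ c) (hC : 0 ≤ C) (ha : 0 < a) (hb : 0 < b)
    (hEn : ∀ θ, ‖E θ‖ = Real.exp (-(b * θ ^ 2)))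
    (h : ∀ θ : ℝ, |θ| ≤ Real.pi →
      ‖φ θ - c * E θ‖ ≤ C * (|θ| * Real.exp (-(a * θ ^ 2)) + q)) :
    ‖(∫ θ in (-Real.pi)..Real.pi, φ θ) - c * ∫ θ : ℝ, E θ‖
      ≤ C * a⁻¹ + c * b⁻¹ + 2 * Real.pi * C * q := by
  have hpi := Real.pi_pos
  have hle : -Real.pi ≤ Real.pi := by linarith
  set I : Set ℝ := Set.Ioc (-Real.pi) Real.pi with hI
  have hIm : MeasurableSet I := measurableSet_Ioc
  have hφi : Integrable (I.indicator φ) :=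
    (integrable_indicator_iff hIm).2 ((hφ.intervalIntegrable _ _).1)
  have hEi : Integrable E := by
    refine (integrable_norm_iff hE.aestronglyMeasurable).1 ?_
    simp only [hEn]
    simpa using integrable_exp_neg_mul_sq hb
  rw [intervalIntegral.integral_of_le hle, ← integral_indicator hIm, ← integral_const_mul,
    ← integral_sub hφi (hEi.const_mul _)]
  have ia := (integrable_abs_mul_exp_neg_mul_sq ha).const_mul C
  have ib := (integrable_abs_mul_exp_neg_mul_sq hb).const_mul c
  have iq : Integrable (I.indicator fun _ => C * q) :=
    (integrable_indicator_iff hIm).2 (integrableOn_const (by simp [hI]))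
  have hbound : ∀ θ, ‖I.indicator φ θ - c * E θ‖ ≤
      C * (|θ| * Real.exp (-(a * θ ^ 2))) + c * (|θ| * Real.exp (-(b * θ ^ 2)))
        + I.indicator (fun _ => C * q) θ := by
    intro θ
    have p1 : 0 ≤ C * (|θ| * Real.exp (-(a * θ ^ 2))) := by positivity
    have p2 : 0 ≤ c * (|θ| * Real.exp (-(b * θ ^ 2))) := by positivity
    by_cases hθ : θ ∈ I
    · rw [Set.indicator_of_mem hθ, Set.indicator_of_mem hθ]
      have := h θ (abs_le.2 ⟨hθ.1.le, hθ.2⟩)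
      linarith
    · rw [Set.indicator_of_notMem hθ, Set.indicator_of_notMem hθ, zero_sub, norm_neg, norm_mul,
        hEn, Complex.norm_real, Real.norm_of_nonneg hc]
      have h1 : 1 ≤ |θ| := by
        by_contra! hlt
        obtain ⟨h2, h3⟩ := abs_lt.1 hlt
        have := Real.pi_gt_three
        exact hθ ⟨by linarith, by linarith⟩
      have : c * Real.exp (-(b * θ ^ 2)) ≤ c * (|θ| * Real.exp (-(b * θ ^ 2))) := by
        gcongr
        exact le_mul_of_one_le_left (Real.exp_pos _).le h1
      linarith
  refine (norm_integral_le_of_norm_le ((ia.add ib).add iq) (Eventually.of_forall hbound)).trans ?_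
  rw [integral_add' (ia.add ib) iq, integral_add' ia ib, integral_const_mul, integral_const_mul,
    integral_abs_mul_exp_neg_mul_sq ha, integral_abs_mul_exp_neg_mul_sq hb,
    integral_indicator hIm]
  refine le_of_eq ?_
  congr 1
  simp [hI, max_eq_left (by linarith : (0 : ℝ) ≤ Real.pi + Real.pi)]
  ring

/-- A local limit theorem: a characteristic function close to a Gaussian one on `[-π, π]` yields a
Gaussian local limit with speed `n ^ (-1 / 2)`. -/
theorem LinRep.local_limit_of_norm_genFun_sub_le {ι : Type*} [Fintype ι] [DecidableEq ι]
    (R : LinRep ι) {lam β γ c C a ρ : ℝ} (hlam : 0 < lam) (hγ : 0 < γ) (hc : 0 < c) (hC : 0 ≤ C)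
    (ha : 0 < a) (hρ0 : 0 ≤ ρ) (hρ1 : ρ < 1)
    (h : ∀ n : ℕ, 1 ≤ n → ∀ θ : ℝ, |θ| ≤ Real.pi →
      ‖R.genFun n (θ * Complex.I) / (lam : ℂ) ^ n
        - c * Complex.exp (β * (θ * Complex.I) + γ / 2 * (θ * Complex.I) ^ 2) ^ n‖
        ≤ C * (|θ| * Real.exp (-(a * n * θ ^ 2)) + ρ ^ n)) :
    ∃ K : ℝ, ∀ᶠ n : ℕ in atTop, ∀ k : ℕ, k ≤ n →
      |Real.sqrt n * R.probY n k
          - Real.exp (-((k : ℝ) - β * n) ^ 2 / (2 * γ * n)) / Real.sqrt (2 * Real.pi * γ)|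
        ≤ K * (n : ℝ) ^ (-(1 / 2) : ℝ) := by
  set s := Real.sqrt (2 * Real.pi * γ) with hs
  have hpi := Real.pi_pos
  have hs0 : 0 < s := Real.sqrt_pos.2 (by positivity)
  set K₁ := C * a⁻¹ + c * (γ / 2)⁻¹ + 2 * Real.pi * C with hK₁
  refine ⟨2 / c * (K₁ / (2 * Real.pi) + C * s⁻¹), ?_⟩
  have e1 : ∀ᶠ n : ℕ in atTop, (n : ℝ) * ρ ^ n < 1 :=
    (tendsto_self_mul_const_pow_of_lt_one hρ0 hρ1).eventually_lt_const one_pos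
  have e2 : ∀ᶠ n : ℕ in atTop, C * ρ ^ n < c / 2 := by
    have := (tendsto_pow_atTop_nhds_zero_of_lt_one hρ0 hρ1).const_mul C
    exact this.eventually_lt_const (by simpa using hc)
  filter_upwards [e1, e2, eventually_ge_atTop 1] with n g1 g2 hn k _
  have hn0 : (0 : ℝ) < n := by exact_mod_cast hn
  have hsn : 0 < Real.sqrt n := Real.sqrt_pos.2 hn0
  have hlc : (lam : ℂ) ≠ 0 := by exact_mod_cast hlam.ne'
  have hρn : ρ ^ n ≤ (n : ℝ)⁻¹ := by
    rw [← one_div, le_div_iff₀ hn0]; linarith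
  set Z := ∑ w : Fin n → Bool, R.series (List.ofFn w) with hZ
  set ζ := Z / lam ^ n with hζ
  -- At `θ = 0` the hypothesis controls the normalising sum itself, which therefore is eventually
  -- nonzero.
  have hζc : |ζ - c| ≤ C * ρ ^ n := by
    have h0 := h n hn 0 (by simpa using hpi.le)
    rw [Complex.ofReal_zero, zero_mul, R.genFun_zero] at h0
    simp only [mul_zero, ne_eq, OfNat.ofNat_ne_zero, not_false_eq_true, zero_pow, add_zero,
      Complex.exp_zero, one_pow, mul_one, abs_zero, zero_mul, zero_add] at h0
    have : ((Z : ℂ) / (lam : ℂ) ^ n - c) = ((ζ - c : ℝ) : ℂ) := by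
      rw [hζ]; push_cast; rfl
    rw [this, Complex.norm_real] at h0
    exact h0
  have hζpos : c / 2 ≤ ζ := by
    have := (abs_le.1 hζc).1
    linarith
  have hZ0 : Z ≠ 0 := by
    intro h0
    rw [hζ, h0, zero_div] at hζpos
    linarith
  set E : ℝ → ℂ := fun θ => Complex.exp (β * (θ * Complex.I) + γ / 2 * (θ * Complex.I) ^ 2) ^ n
    * Complex.exp (-(k * θ * Complex.I)) with hE
  set φ : ℝ → ℂ := fun θ => R.genFun n (θ * Complex.I) * Complex.exp (-(k * θ * Complex.I))
    / (lam : ℂ) ^ n with hφ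
  have hφc : Continuous φ := by
    simp only [hφ, genFun_eq_sum]
    fun_prop
  have hnk : ∀ θ : ℝ, ‖Complex.exp (-(k * θ * Complex.I))‖ = 1 := by
    intro θ
    have : -(k * θ * Complex.I) = ((-(k * θ) : ℝ) : ℂ) * Complex.I := by push_cast; ring
    rw [this, Complex.norm_exp_ofReal_mul_I]
  have hint := norm_integral_sub_le (φ := φ) (E := E) (c := c) (C := C) (a := a * n)
    (b := γ / 2 * n) (q := ρ ^ n) hφc (by simp only [hE]; fun_prop) hc.le hC (by positivity)
    (by positivity) (by
      intro θ
      simp only [hE]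
      rw [norm_mul, hnk, mul_one, norm_pow, norm_exp_quadratic, ← Real.exp_nat_mul]
      congr 1
      ring) (by
      intro θ hθ
      have h1 := h n hn θ hθ
      have h2 : φ θ - c * E θ = (R.genFun n (θ * Complex.I) / (lam : ℂ) ^ n
        - c * Complex.exp (β * (θ * Complex.I) + γ / 2 * (θ * Complex.I) ^ 2) ^ n)
        * Complex.exp (-(k * θ * Complex.I)) := by
        simp only [hφ, hE]; ring
      rw [h2, norm_mul, hnk, mul_one]
      exact h1)
  rw [integral_exp_quadratic_pow hγ hn k, ← hs] at hint
  simp only [hφ] at hint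
  rw [intervalIntegral.integral_div, R.integral_genFun n k hZ0, ← hZ] at hint
  set G := Real.exp (-((k : ℝ) - β * n) ^ 2 / (2 * γ * n)) / s with hG
  set p := R.probY n k with hp
  have hG0 : 0 ≤ G := by positivity
  have hGs : G ≤ s⁻¹ := by
    rw [hG, div_eq_mul_inv]
    refine mul_le_of_le_one_left (by positivity) (Real.exp_le_one_iff.2 ?_)
    exact div_nonpos_of_nonpos_of_nonneg (by simpa using sq_nonneg _) (by positivity)
  have hreal : ((2 * Real.pi * (Z * p) : ℝ) : ℂ) / (lam : ℂ) ^ n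
      - c * ((2 * Real.pi * (G / Real.sqrt n) : ℝ) : ℂ)
      = ((2 * Real.pi * (ζ * p - c * (G / Real.sqrt n)) : ℝ) : ℂ) := by
    rw [hζ]; push_cast; ring
  rw [hreal, Complex.norm_real, Real.norm_eq_abs, abs_mul, abs_of_pos (by positivity)] at hint
  have hint2 : |ζ * p - c * (G / Real.sqrt n)| ≤ K₁ / (2 * Real.pi) * (n : ℝ)⁻¹ := by
    have h1 : C * (a * n)⁻¹ + c * (γ / 2 * n)⁻¹ + 2 * Real.pi * C * ρ ^ n ≤ K₁ * (n : ℝ)⁻¹ := by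
      have : 2 * Real.pi * C * ρ ^ n ≤ 2 * Real.pi * C * (n : ℝ)⁻¹ := by gcongr
      rw [hK₁, mul_inv, mul_inv]
      linarith
    rw [div_mul_eq_mul_div K₁, le_div_iff₀ (by positivity)]
    linarith
  have hζG : |(ζ - c) * G| ≤ C * s⁻¹ * (n : ℝ)⁻¹ := by
    rw [abs_mul, abs_of_nonneg hG0]
    calc |ζ - c| * G ≤ (C * (n : ℝ)⁻¹) * s⁻¹ := by
          gcongr
          exact hζc.trans (by gcongr)
      _ = _ := by ring
  -- Fourier inversion estimates `ζ p`, not `p`; replacing `c` by `ζ` costs only `(ζ - c) G`.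
  have hkey : Real.sqrt n * p - G
      = (Real.sqrt n * (ζ * p - c * (G / Real.sqrt n)) - (ζ - c) * G) / ζ := by
    have : ζ ≠ 0 := by linarith
    field_simp
    ring
  have hζ0 : 0 < ζ := by linarith
  have hrp : (n : ℝ) ^ (-(1 / 2) : ℝ) = (Real.sqrt n)⁻¹ := by
    rw [Real.rpow_neg hn0.le, Real.sqrt_eq_rpow]
  have hsq : Real.sqrt n * (n : ℝ)⁻¹ = (Real.sqrt n)⁻¹ := by
    conv_lhs => rw [← Real.mul_self_sqrt hn0.le]
    rw [Real.sqrt_mul_self hsn.le]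
    field_simp
  have hninv : (n : ℝ)⁻¹ ≤ (Real.sqrt n)⁻¹ := by
    rw [← hsq]
    refine le_mul_of_one_le_left (by positivity) ?_
    rw [Real.one_le_sqrt]
    exact_mod_cast hn
  have hK₁0 : 0 ≤ K₁ := by positivity
  rw [hkey, hrp, abs_div, abs_of_pos hζ0, div_le_iff₀ hζ0]
  calc |Real.sqrt n * (ζ * p - c * (G / Real.sqrt n)) - (ζ - c) * G|
      ≤ Real.sqrt n * (K₁ / (2 * Real.pi) * (n : ℝ)⁻¹) + C * s⁻¹ * (n : ℝ)⁻¹ := by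
        refine (abs_sub _ _).trans (add_le_add ?_ hζG)
        rw [abs_mul, abs_of_pos hsn]
        gcongr
    _ = K₁ / (2 * Real.pi) * (Real.sqrt n)⁻¹ + C * s⁻¹ * (n : ℝ)⁻¹ := by rw [← hsq]; ring
    _ ≤ K₁ / (2 * Real.pi) * (Real.sqrt n)⁻¹ + C * s⁻¹ * (Real.sqrt n)⁻¹ := by gcongr
    _ = (2 / c * (K₁ / (2 * Real.pi) + C * s⁻¹) * (Real.sqrt n)⁻¹) * (c / 2) := by
        field_simp
    _ ≤ _ := by gcongr

theorem mainTheorem8 {ι₁ ι₂ : Type*} [Fintype ι₁] [DecidableEq ι₁] [Fintype ι₂] [DecidableEq ι₂]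
    (R₁ : LinRep ι₁) (R₂ : LinRep ι₂) (hmodel : LinRep.IsEquipotentSumModel R₁ R₂)
    (hap₁ : R₁.AperiodicPair) (hap₂ : R₂.AperiodicPair) (β γ : ℝ)
    (hβ₁ : R₁.beta = β) (hβ₂ : R₂.beta = β) (hγ₁ : R₁.gamma = γ) (hγ₂ : R₂.gamma = γ) :
    0 < γ ∧ ∃ C : ℝ, ∀ᶠ n : ℕ in atTop, ∀ k : ℕ, k ≤ n →
      |Real.sqrt n * (R₁.directSum R₂).probY n k
          - Real.exp (-((k : ℝ) - β * n) ^ 2 / (2 * γ * n)) / Real.sqrt (2 * Real.pi * γ)|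
        ≤ C * (n : ℝ) ^ (-(1 / 2) : ℝ) := by
  obtain ⟨hlam, hγ, c₁, C₁, a₁, ρ₁, hc₁, hC₁, ha₁, hρ₁, hρ₁', h₁⟩ :=
    LinRep.component_estimate hmodel.primitive₁ hap₁ hmodel.ξ₁_ne_zero hmodel.η₁_ne_zero
  obtain ⟨-, -, c₂, C₂, a₂, ρ₂, hc₂, hC₂, ha₂, hρ₂, hρ₂', h₂⟩ :=
    LinRep.component_estimate hmodel.primitive₂ hap₂ hmodel.ξ₂_ne_zero hmodel.η₂_ne_zero
  rw [hγ₁] at hγ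
  -- The Gaussian factors coincide, so the constants add; the weaker of the two decay rates bounds
  -- both errors.
  refine ⟨hγ, (R₁.directSum R₂).local_limit_of_norm_genFun_sub_le (c := c₁ + c₂) (C := C₁ + C₂)
    (a := min a₁ a₂) (ρ := max ρ₁ ρ₂) hlam hγ (by positivity) (by positivity) (lt_min ha₁ ha₂)
    (le_max_of_le_left hρ₁) (max_lt hρ₁' hρ₂') fun n hn θ hθ => ?_⟩
  have g₁ := h₁ n hn θ hθ
  have g₂ := h₂ n hn θ hθ
  rw [hβ₁, hγ₁] at g₁
  rw [hβ₂, hγ₂, ← hmodel.perron_eq] at g₂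
  rw [LinRep.genFun_directSum]
  set E := Complex.exp (β * (θ * Complex.I) + γ / 2 * (θ * Complex.I) ^ 2) ^ n
  have hsplit : (R₁.genFun n (θ * Complex.I) + R₂.genFun n (θ * Complex.I))
        / (R₁.perronEigenvalue : ℂ) ^ n - ((c₁ + c₂ : ℝ) : ℂ) * E
      = (R₁.genFun n (θ * Complex.I) / (R₁.perronEigenvalue : ℂ) ^ n - c₁ * E)
        + (R₂.genFun n (θ * Complex.I) / (R₁.perronEigenvalue : ℂ) ^ n - c₂ * E) := by
    push_cast; ring
  rw [hsplit]
  refine (norm_add_le _ _).trans ((add_le_add g₁ g₂).trans ?_)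
  rw [add_mul]
  gcongr <;> simp
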